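/- Let $\mathcal H=\mathbb C^2\otimes\mathbb C^2\otimes\mathbb C^2\otimes\mathbb C^2$, with the natural action of $\mathrm{SL}_{loc}=\mathrm{SL}_2(\mathbb C)^4$ and of $\mathrm{SL}_{loc}^*=\mathrm{SL}_{loc}\rtimes\mathrm{Sym}_4$, where $\mathrm{Sym}_4$ permutes the four qubits (tensor factors). For $\psi=\sum\psi_{ijkl}\,e_i\otimes e_j\otimes e_k\otimes e_l$ let $\tilde\psi$ be the $4\times4$ matrix with rows indexed by $ij$ and columns by $kl$ (in the order $00,01,10,11$), and let $R_\psi=T\tilde\psi T^\dagger$ with $$T=\frac1{\sqrt2}\begin{bmatrix}1&0&0&1\\0&i&i&0\\0&-1&1&0\\i&0&0&-i\end{bmatrix}.$$ Let $\mathfrak a\subset\mathcal H$ be the (Cartan) subspace of those $\psi$ for which $R_\psi$ is diagonal, with the diagonal entries $(a,b,c,d)$ of $R_\psi$ as coordinates. Let $N_{\mathfrak a}$ and $Z_{\mathfrak a}$ be the subgroups of $\mathrm{SL}_{loc}$ that leave $\mathfrak a$ globally, respectively pointwise, invariant, define $N_{\mathfrak a}^*,Z_{\mathfrak a}^*\subset\mathrm{SL}_{loc}^*$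 in the same way, and put $W_{\mathfrak a}=N_{\mathfrak a}/Z_{\mathfrak a}$, $W_{\mathfrak a}^*=N_{\mathfrak a}^*/Z_{\mathfrak a}^*$; both groups act on $\mathfrak a$. Lemma. The group $W_{\mathfrak a}^*$ has order $1152=2^7\cdot 3^2$ and, with its action on $\mathfrak a$, is the Weyl group of a root system of type $F_4$ in $\mathfrak a$. Moreover, $W_{\mathfrak a}$, with its action on $\mathfrak a$, is the Weyl group of a root system of type $D_4$ in $\mathfrak a$; the natural map $W_{\mathfrak a}\to W_{\mathfrak a}^*$ is injective; all qubit permutations belong to $N_{\mathfrak a}^*$; and $W_{\mathfrak a}^*$ is generated by $W_{\mathfrak a}$ together with the images of the two qubit transpositions $(1,2)$ and $(2,3)$, which act on $\mathfrak a$ as the reflections $$(a,b,c,d)\mapsto(a,b,-c,d)$$ and $$(a,b,c,d)\mapsto\tfrac12(a+b+c+d,\;a+b-c-d,\;a-b+c-d,\;a-b-c+d)$$ (the reflection in the hyperplane $a=b+c+d$), respectively. -/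

import Mathlib

open scoped Matrix

namespace FourQubits

noncomputable section

/-! ### Groups induced on a subspace by a linear representation -/

section Induced

variable {G V : Type*} [Group G] [AddCommGroup V] [Module ℂ V]

/-- The subgroup of `G` leaving the subspace `U` globally invariant. -/
def setStab (ρ : G →* (V ≃ₗ[ℂ] V)) (U : Submodule ℂ V) : Subgroup G where
  carrier := {g | U.map (ρ g : V →ₗ[ℂ] V) = U}
  one_mem' := by
    simp only [Set.mem_ofPred_eq, map_one]
    exact Submodule.map_id U
  mul_mem' := by
    intro g h hg hh
    simp only [Set.mem_ofPred_eq, map_mul] at *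
    have : ((ρ g * ρ h : V ≃ₗ[ℂ] V) : V →ₗ[ℂ] V) = (ρ g : V →ₗ[ℂ] V) ∘ₗ (ρ h : V →ₗ[ℂ] V) := rfl
    rw [this, Submodule.map_comp, hh, hg]
  inv_mem' := by
    intro g hg
    simp only [Set.mem_ofPred_eq] at *
    conv_lhs => rw [← hg]
    rw [← Submodule.map_comp]
    have : ((ρ g⁻¹ : V ≃ₗ[ℂ] V) : V →ₗ[ℂ] V) ∘ₗ (ρ g : V →ₗ[ℂ] V) = LinearMap.id := by
      ext x
      change (ρ g⁻¹ * ρ g) x = x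
      rw [← map_mul]
      simp
    rw [this, Submodule.map_id]

/-- The subgroup of `G` leaving the subspace `U` pointwise invariant. -/
def ptStab (ρ : G →* (V ≃ₗ[ℂ] V)) (U : Submodule ℂ V) : Subgroup G where
  carrier := {g | ∀ x ∈ U, ρ g x = x}
  one_mem' := by intro x _; simp
  mul_mem' := by
    intro g h hg hh x hx
    rw [map_mul, LinearEquiv.mul_apply, hh x hx, hg x hx]
  inv_mem' := by
    intro g hg x hx
    have h : ρ g⁻¹ (ρ g x) = x := by
      rw [← LinearEquiv.mul_apply, ← map_mul]
      simp
    rwa [hg x hx] at h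

theorem apply_mem {ρ : G →* (V ≃ₗ[ℂ] V)} {U : Submodule ℂ V} (g : setStab ρ U) {x : V}
    (hx : x ∈ U) : ρ g x ∈ U := by
  have h : U.map (ρ (g : G) : V →ₗ[ℂ] V) = U := g.2
  exact h.le (Submodule.mem_map_of_mem hx)

/-- The pointwise stabilizer, as a subgroup of the global stabilizer. -/
abbrev ptStabIn (ρ : G →* (V ≃ₗ[ℂ] V)) (U : Submodule ℂ V) : Subgroup (setStab ρ U) :=
  (ptStab ρ U).subgroupOf (setStab ρ U)

instance ptStabIn_normal (ρ : G →* (V ≃ₗ[ℂ] V)) (U : Submodule ℂ V) : (ptStabIn ρ U).Normal where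
  conj_mem := by
    intro n hn g x hx
    have h1 : ρ (g⁻¹ : setStab ρ U) x ∈ U := apply_mem g⁻¹ hx
    have h2 : ρ (n : G) (ρ (g⁻¹ : setStab ρ U) x) = ρ (g⁻¹ : setStab ρ U) x := hn _ h1
    change ρ ((g : G) * n * (g : G)⁻¹) x = x
    rw [map_mul, map_mul, LinearEquiv.mul_apply, LinearEquiv.mul_apply]
    change ρ (g : G) (ρ (n : G) (ρ (g⁻¹ : setStab ρ U) x)) = x
    rw [h2]
    change ρ (g : G) (ρ (g : G)⁻¹ x) = x
    rw [← LinearEquiv.mul_apply, ← map_mul]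
    simp

/-- The group `N / Z` induced on `U`, where `N` and `Z` are the global and the pointwise stabilizer
of `U`. -/
abbrev InducedGroup (ρ : G →* (V ≃ₗ[ℂ] V)) (U : Submodule ℂ V) : Type _ :=
  setStab ρ U ⧸ ptStabIn ρ U

/-- The action of the global stabilizer of `U` on `U`. -/
def stabAction (ρ : G →* (V ≃ₗ[ℂ] V)) (U : Submodule ℂ V) : setStab ρ U →* (U →ₗ[ℂ] U) where
  toFun g := (ρ (g : G) : V →ₗ[ℂ] V).restrict fun _ hx => apply_mem g hx
  map_one' := by
    ext x
    simp [LinearMap.restrict_apply]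
  map_mul' g h := by
    ext x
    simp [LinearMap.restrict_apply]

/-- The action of `N / Z` on `U`. -/
def inducedAction (ρ : G →* (V ≃ₗ[ℂ] V)) (U : Submodule ℂ V) :
    InducedGroup ρ U →* (U →ₗ[ℂ] U) :=
  QuotientGroup.lift (ptStabIn ρ U) (stabAction ρ U) fun _ hg =>
    LinearMap.ext fun x => Subtype.ext (hg x.1 x.2)

/-- The homomorphism of induced groups that comes from a homomorphism `f : K → G` of groups, where
`K` acts through `f`. -/
def inducedMap {K : Type*} [Group K] (f : K →* G) (ρ : G →* (V ≃ₗ[ℂ] V)) (U : Submodule ℂ V) :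
    InducedGroup (ρ.comp f) U →* InducedGroup ρ U :=
  QuotientGroup.map (ptStabIn (ρ.comp f) U) (ptStabIn ρ U)
    ((f.comp (setStab (ρ.comp f) U).subtype).codRestrict (setStab ρ U) fun g => g.2)
    fun _ hg => hg

end Induced

/-- The group `W`, acting linearly on the complex vector space `U` through `τ`, is the Weyl group of
a reduced crystallographic root system in `U` whose Cartan matrix (for some base and some numbering
of its simple roots) is `C`; here the Weyl group is taken together with its action on `U`. -/
def IsWeylGroupOfType {W U : Type*} [Group W] [AddCommGroup U] [Module ℂ U]
    (τ : W →* (U →ₗ[ℂ] U)) {n : ℕ} (C : Matrix (Fin n) (Fin n) ℤ) : Prop :=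
  ∃ (ι : Type) (_ : Finite ι) (P : RootPairing ι ℂ U (Module.Dual ℂ U)) (_ : P.IsRootSystem)
    (_ : P.IsCrystallographic) (_ : P.IsReduced) (b : P.Base) (e : b.support ≃ Fin n),
    b.cartanMatrix.reindex e e = C ∧
      ∃ φ : W ≃* P.weylGroup, ∀ (w : W) (x : U), φ w • x = τ w x

/-! ### Four qubits -/

/-- The tensors `ψ = ∑ ψ_{ijkl} e_i ⊗ e_j ⊗ e_k ⊗ e_l` in `ℂ² ⊗ ℂ² ⊗ ℂ² ⊗ ℂ²`; the coefficient
`ψ_{ijkl}` is `ψ ![i, j, k, l]`. -/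
abbrev State : Type := (Fin 4 → Fin 2) → ℂ

/-- `SL₂(ℂ) × SL₂(ℂ) × SL₂(ℂ) × SL₂(ℂ)`. -/
abbrev SLloc : Type := Fin 4 → Matrix.SpecialLinearGroup (Fin 2) ℂ

/-- `SL_loc · Sym₄`: a permutation `σ` conjugates `(A_k)` into `(A_{σ⁻¹ k})`. -/
abbrev SLlocStar : Type :=
  SLloc ⋊[(mulAutArrow : Equiv.Perm (Fin 4) →* MulAut SLloc)] Equiv.Perm (Fin 4)

/-- The operator `A₀ ⊗ A₁ ⊗ A₂ ⊗ A₃`. -/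
def localOp (A : SLloc) : State →ₗ[ℂ] State :=
  Matrix.toLin' (Matrix.of fun x y => ∏ k, (A k : Matrix (Fin 2) (Fin 2) ℂ) (x k) (y k))

/-- The permutation of the qubits which moves the `k`-th qubit to the place `σ k`. -/
def permOp (σ : Equiv.Perm (Fin 4)) : State →ₗ[ℂ] State :=
  LinearMap.funLeft ℂ ℂ fun x => x ∘ σ

theorem localOp_apply (A : SLloc) (ψ : State) (x : Fin 4 → Fin 2) :
    localOp A ψ x = ∑ y, (∏ k, (A k : Matrix (Fin 2) (Fin 2) ℂ) (x k) (y k)) * ψ y := rfl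

theorem permOp_apply (σ : Equiv.Perm (Fin 4)) (ψ : State) (x : Fin 4 → Fin 2) :
    permOp σ ψ x = ψ (x ∘ σ) := rfl

theorem localOp_one : localOp 1 = LinearMap.id := by
  have h : (Matrix.of fun x y : Fin 4 → Fin 2 =>
      ∏ k, (((1 : SLloc) k : Matrix.SpecialLinearGroup (Fin 2) ℂ) : Matrix (Fin 2) (Fin 2) ℂ)
        (x k) (y k)) = 1 := by
    ext x y
    by_cases hxy : x = y
    · subst hxy
      simp
    · obtain ⟨k, hk⟩ := Function.ne_iff.mp hxy
      rw [Matrix.one_apply_ne hxy, Matrix.of_apply]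
      exact Finset.prod_eq_zero (Finset.mem_univ k) (by simp [Matrix.one_apply_ne hk])
  rw [localOp, h, Matrix.toLin'_one]

theorem localOp_mul (A B : SLloc) : localOp (A * B) = localOp A ∘ₗ localOp B := by
  rw [localOp, localOp, localOp, ← Matrix.toLin'_mul]
  congr 1
  ext x z
  simp only [Matrix.of_apply, Matrix.mul_apply, Pi.mul_apply, Matrix.SpecialLinearGroup.coe_mul,
    ← Finset.prod_mul_distrib]
  rw [Finset.prod_univ_sum]
  simp

theorem permOp_localOp (σ : Equiv.Perm (Fin 4)) (A : SLloc) :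
    permOp σ ∘ₗ localOp A = localOp (mulAutArrow σ A) ∘ₗ permOp σ := by
  refine LinearMap.ext fun ψ => funext fun x => ?_
  simp only [LinearMap.comp_apply, permOp_apply, localOp_apply]
  refine Fintype.sum_equiv (Equiv.arrowCongr σ (Equiv.refl _)) _ _ fun y => ?_
  congr 1
  · refine Fintype.prod_equiv σ _ _ fun k => ?_
    have hk : (mulAutArrow σ A) (σ k) = A (σ⁻¹ (σ k)) := rfl
    rw [hk, Equiv.Perm.inv_def, Equiv.symm_apply_apply]
    simp
  · congr 1
    funext k
    simp

/-- The action of `SL_loc · Sym₄` on the tensors. -/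
def starActionHom : SLlocStar →* (State →ₗ[ℂ] State) where
  toFun g := localOp g.left ∘ₗ permOp g.right
  map_one' := by
    ext1 ψ
    simp only [SemidirectProduct.one_left, SemidirectProduct.one_right, localOp_one]
    rfl
  map_mul' g h := by
    have hp : permOp (g.right * h.right) = permOp g.right ∘ₗ permOp h.right := rfl
    rw [SemidirectProduct.mul_left, SemidirectProduct.mul_right, localOp_mul, hp,
      LinearMap.comp_assoc, ← LinearMap.comp_assoc _ _ (localOp (mulAutArrow g.right h.left)),
      ← permOp_localOp]
    rfl

/-- The same action, through invertible operators. -/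
def starAction : SLlocStar →* (State ≃ₗ[ℂ] State) :=
  (LinearMap.GeneralLinearGroup.generalLinearEquiv ℂ State).toMonoidHom.comp
    starActionHom.toHomUnits

theorem starAction_apply (g : SLlocStar) (ψ : State) :
    starAction g ψ = localOp g.left (permOp g.right ψ) := rfl

/-- The inclusion of `SL_loc` in `SL_loc · Sym₄`. -/
abbrev locIncl : SLloc →* SLlocStar := SemidirectProduct.inl

/-- The qubit permutations in `SL_loc · Sym₄`. -/
abbrev qubitPerm : Equiv.Perm (Fin 4) →* SLlocStar := SemidirectProduct.inr

/-! ### The Cartan subspace -/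

/-- The `4 × 4` matrix of a tensor, with row index `ij` and column index `kl`, both in the order
`00, 01, 10, 11`. -/
def tildeMat (ψ : State) : Matrix (Fin 4) (Fin 4) ℂ :=
  Matrix.of fun r c =>
    let p : Fin 2 × Fin 2 := finProdFinEquiv.symm r
    let q : Fin 2 × Fin 2 := finProdFinEquiv.symm c
    ψ ![p.1, p.2, q.1, q.2]

/-- The unitary matrix `T`. -/
def Tmat : Matrix (Fin 4) (Fin 4) ℂ :=
  (((Real.sqrt 2 : ℝ) : ℂ)⁻¹) •
    !![1, 0, 0, 1;
       0, Complex.I, Complex.I, 0;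
       0, -1, 1, 0;
       Complex.I, 0, 0, -Complex.I]

/-- `R_ψ = T ψ̃ T†`. -/
def Rmat (ψ : State) : Matrix (Fin 4) (Fin 4) ℂ := Tmat * tildeMat ψ * Tmatᴴ

theorem Rmat_add (ψ φ : State) : Rmat (ψ + φ) = Rmat ψ + Rmat φ := by
  have h : tildeMat (ψ + φ) = tildeMat ψ + tildeMat φ := rfl
  rw [Rmat, h, Matrix.mul_add, Matrix.add_mul]
  rfl

theorem Rmat_smul (c : ℂ) (ψ : State) : Rmat (c • ψ) = c • Rmat ψ := by
  have h : tildeMat (c • ψ) = c • tildeMat ψ := rfl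
  rw [Rmat, h, Matrix.mul_smul, Matrix.smul_mul]
  rfl

/-- The Cartan subspace: the tensors `ψ` such that `R_ψ` is a diagonal matrix. -/
def cartan : Submodule ℂ State where
  carrier := {ψ | (Rmat ψ).IsDiag}
  zero_mem' := by
    have h : Rmat 0 = 0 := by simpa using Rmat_smul 0 0
    simp [h]
  add_mem' := by
    intro ψ φ hψ hφ
    simp only [Set.mem_ofPred_eq, Rmat_add] at *
    exact hψ.add hφ
  smul_mem' := by
    intro c ψ hψ
    simp only [Set.mem_ofPred_eq, Rmat_smul] at *
    exact hψ.smul c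

/-- `N_𝔞^*`, the global stabilizer of the Cartan subspace in `SL_loc · Sym₄`. -/
abbrev Nstar : Subgroup SLlocStar := setStab starAction cartan

/-- `W_𝔞^* = N_𝔞^* / Z_𝔞^*`. -/
abbrev Wstar : Type := InducedGroup starAction cartan

/-- `W_𝔞 = N_𝔞 / Z_𝔞`. -/
abbrev Wloc : Type := InducedGroup (starAction.comp locIncl) cartan

/-- The action of `W_𝔞^*` on the Cartan subspace. -/
abbrev WstarAction : Wstar →* (cartan →ₗ[ℂ] cartan) := inducedAction starAction cartan

/-- The action of `W_𝔞` on the Cartan subspace. -/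
abbrev WlocAction : Wloc →* (cartan →ₗ[ℂ] cartan) := inducedAction (starAction.comp locIncl) cartan

/-- The natural homomorphism `W_𝔞 → W_𝔞^*`. -/
abbrev WlocToWstar : Wloc →* Wstar := inducedMap locIncl starAction cartan

end

end FourQubits

/-!
In the basis given by `T`, the operator `A ⊗ B` on two qubits with `A, B ∈ SL₂(ℂ)` becomes an
element of `SO₄(ℂ)` (`orthMat_transpose_mul_self`, `det_orthMat`), so that a local operator acts by
`R ↦ O₁ R O₂` on the matrices `R = R_ψ`, and the Cartan subspace consists of the diagonal ones. Such
a map, if it stabilizes the diagonal matrices, takes a diagonal matrix of rank one to a diagonal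
matrix of rank one and preserves `tr RᵀR` and `det R`. Hence it permutes the diagonal entries up to
an even number of signs (`exists_eq_signedPerm_of_orthogonal`). Conversely, the simple reflections
of type `D₄` come from tensor products of the matrices `(1 ± i X) / √2` or `(1 ± i Z) / √2`, which are
rotations by a right angle in a coordinate plane (`exists_localOp_eq_refl`). This determines the
image of `W_𝔞` in the coordinates `(a, b, c, d)`: it is generated by the simple reflections of type
`D₄`.

The adjacent qubit transpositions act on the Cartan subspace by two reflections, those in the short
simple roots of type `F₄` (`permOp_cartanState`). As `W_𝔞^*` is generated by `W_𝔞` and the qubit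
permutations, its image is generated by the simple reflections of type `F₄` (`mrange_starRep`). The
two short reflections generate a symmetric group on three letters, and the image is the disjoint
union of three cosets of the group of the `2⁴ · 4!` signed permutations (`range_starRep`,
`signedPerm_mul_cosetRep_injective`), which gives the order `1152`.

That a group acting faithfully with such an image is a Weyl group in the sense of `RootPairing` is
`isWeylGroupOfType_of_mrange_eq`. It rests on explicit lists of integer vectors for the roots, for
which the axioms of a root system and the Cartan matrix are verified by computation.
-/

namespace FourQubits

noncomputable section

open scoped Kronecker

/-! ### Root systems given by integer vectors -/

section IntegerRoots

variable {n : ℕ}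

/-- An integer vector, regarded as a complex vector. -/
def toC (v : Fin n → ℤ) : Fin n → ℂ := fun i => (v i : ℂ)

/-- The linear form `x ↦ 2 ⟨v, x⟩ / ⟨v, v⟩`, the coroot of `v` for the standard bilinear form. -/
def corootForm (v : Fin n → ℤ) : Module.Dual ℂ (Fin n → ℂ) :=
  (2 / ((v ⬝ᵥ v : ℤ) : ℂ)) • ∑ i, (v i : ℂ) • LinearMap.proj i

theorem corootForm_apply (v : Fin n → ℤ) (x : Fin n → ℂ) :
    corootForm v x = 2 / ((v ⬝ᵥ v : ℤ) : ℂ) * ∑ i, (v i : ℂ) * x i := by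
  simp [corootForm]

theorem corootForm_toC (v w : Fin n → ℤ) :
    corootForm v (toC w) = 2 * ((w ⬝ᵥ v : ℤ) : ℂ) / ((v ⬝ᵥ v : ℤ) : ℂ) := by
  rw [corootForm_apply]
  simp only [toC, dotProduct]
  push_cast
  rw [div_mul_eq_mul_div]
  simp only [mul_comm]

/-- The orthogonal reflection in the hyperplane perpendicular to an integer vector. -/
def refl (v : Fin n → ℤ) : Module.End ℂ (Fin n → ℂ) :=
  Module.preReflection (toC v) (corootForm v)

theorem refl_apply (v : Fin n → ℤ) (x : Fin n → ℂ) (i : Fin n) :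
    refl v x i = x i - (2 / ((v ⬝ᵥ v : ℤ) : ℂ) * ∑ j, (v j : ℂ) * x j) * v i := by
  rw [refl, Module.preReflection_apply, corootForm_apply]
  rfl

/-- A finite set `S` of integer vectors which is, for the standard bilinear form, a reduced
crystallographic root system with base `α`, the Cartan matrix being `C`. The coefficients of the
roots with respect to the base are given by `c`. -/
structure IsIntegerRootSystem (S : Finset (Fin n → ℤ)) (α : Fin n → Fin n → ℤ)
    (c : (Fin n → ℤ) → Fin n → ℤ) (C : Matrix (Fin n) (Fin n) ℤ) : Prop where
  simple_mem : ∀ i, α i ∈ S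
  self_ne_zero : ∀ v ∈ S, v ⬝ᵥ v ≠ 0
  reflect : ∀ v ∈ S, ∀ w ∈ S, (v ⬝ᵥ v) ∣ 2 * (w ⬝ᵥ v) ∧ w - (2 * (w ⬝ᵥ v) / (v ⬝ᵥ v)) • v ∈ S
  reduced : ∀ v ∈ S, ∀ w ∈ S, (v ⬝ᵥ w) * (v ⬝ᵥ w) = (v ⬝ᵥ v) * (w ⬝ᵥ w) → v = w ∨ v = -w
  combination : ∀ v ∈ S, v = ∑ i, c v i • α i ∧ ((∀ i, 0 ≤ c v i) ∨ ∀ i, c v i ≤ 0)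
  det_ne_zero : Matrix.det (Matrix.of α) ≠ 0
  cartan : ∀ i j, 2 * (α i ⬝ᵥ α j) = C i j * (α j ⬝ᵥ α j)

theorem linearIndependent_toC {α : Fin n → Fin n → ℤ} (h : Matrix.det (Matrix.of α) ≠ 0) :
    LinearIndependent ℂ fun i => toC (α i) := by
  have h1 : IsUnit ((Matrix.of α).map (Int.castRingHom ℂ)).det := by
    rw [← RingHom.mapMatrix_apply, ← RingHom.map_det]
    simpa using h
  exact Matrix.linearIndependent_rows_of_isUnit ((Matrix.isUnit_iff_isUnit_det _).2 h1)

theorem toC_injective : Function.Injective (toC (n := n)) := fun _ _ h =>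
  funext fun i => Int.cast_injective (α := ℂ) (congrFun h i)

theorem toC_sub_smul (v w : Fin n → ℤ) (k : ℤ) : toC (w - k • v) = toC w - (k : ℂ) • toC v := by
  ext i
  simp [toC]

/-- The Gram determinant of two linearly dependent vectors vanishes. -/
theorem gram_of_not_linearIndependent {v w : Fin n → ℤ}
    (h : ¬ LinearIndependent ℂ ![toC v, toC w]) :
    (v ⬝ᵥ w) * (v ⬝ᵥ w) = (v ⬝ᵥ v) * (w ⬝ᵥ w) := by
  rw [LinearIndependent.pair_iff] at h
  push Not at h
  obtain ⟨s, t, hst, h0⟩ := h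
  have key : ∀ u : Fin n → ℤ, s * ((v ⬝ᵥ u : ℤ) : ℂ) + t * ((w ⬝ᵥ u : ℤ) : ℂ) = 0 := by
    intro u
    have h1 : (s • toC v + t • toC w) ⬝ᵥ toC u = 0 := by rw [hst, zero_dotProduct]
    rw [add_dotProduct, smul_dotProduct, smul_dotProduct] at h1
    simpa [dotProduct, toC] using h1
  have hv := key v
  have hw := key w
  rw [dotProduct_comm w v] at hv
  have hz : ((v ⬝ᵥ w : ℤ) : ℂ) * (v ⬝ᵥ w : ℤ) = (v ⬝ᵥ v : ℤ) * (w ⬝ᵥ w : ℤ) := by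
    by_cases hs : s = 0
    · have ht : t ≠ 0 := h0 hs
      apply mul_left_cancel₀ ht
      linear_combination ((v ⬝ᵥ w : ℤ) : ℂ) * hv - ((v ⬝ᵥ v : ℤ) : ℂ) * hw
    · apply mul_left_cancel₀ hs
      linear_combination ((v ⬝ᵥ w : ℤ) : ℂ) * hw - ((w ⬝ᵥ w : ℤ) : ℂ) * hv
  exact_mod_cast hz

variable {S : Finset (Fin n → ℤ)} {α : Fin n → Fin n → ℤ} {c : (Fin n → ℤ) → Fin n → ℤ}
  {C : Matrix (Fin n) (Fin n) ℤ} {U : Type*} [AddCommGroup U] [Module ℂ U]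

/-- The root of `U` whose coordinates are a given integer vector. -/
def rootEmb (S : Finset (Fin n → ℤ)) (e : U ≃ₗ[ℂ] (Fin n → ℂ)) : S ↪ U where
  toFun v := e.symm (toC v)
  inj' _ _ h := Subtype.ext (toC_injective (e.symm.injective h))

theorem corootForm_self {v : Fin n → ℤ} (h : v ⬝ᵥ v ≠ 0) : corootForm v (toC v) = 2 := by
  rw [corootForm_toC]
  have h' : ((v ⬝ᵥ v : ℤ) : ℂ) ≠ 0 := by exact_mod_cast h
  field_simp

/-- The coroot of `U` belonging to a given integer vector. Vectors with the same
coroot are proportional, hence equal up to sign, and opposite vectors have opposite coroots. -/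
def corootEmb (h : IsIntegerRootSystem S α c C) (e : U ≃ₗ[ℂ] (Fin n → ℂ)) :
    S ↪ Module.Dual ℂ U where
  toFun v := (corootForm (v : Fin n → ℤ)).comp e.toLinearMap
  inj' := by
    intro v w hvw
    have hv0 := h.self_ne_zero v v.2
    have hw0 := h.self_ne_zero w w.2
    have key : ∀ x, corootForm (v : Fin n → ℤ) x = corootForm (w : Fin n → ℤ) x := fun x => by
      simpa using LinearMap.congr_fun hvw (e.symm x)
    have hv0' : (((v : Fin n → ℤ) ⬝ᵥ (v : Fin n → ℤ) : ℤ) : ℂ) ≠ 0 := by exact_mod_cast hv0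
    have hw0' : (((w : Fin n → ℤ) ⬝ᵥ (w : Fin n → ℤ) : ℤ) : ℂ) ≠ 0 := by exact_mod_cast hw0
    have h1 := key (toC v)
    have h2 := key (toC w)
    rw [corootForm_self hv0, corootForm_toC] at h1
    rw [corootForm_self hw0, corootForm_toC] at h2
    rw [dotProduct_comm] at h2
    field_simp at h1 h2
    -- Equality holds in the Cauchy-Schwarz inequality, so that `v = ± w`.
    have h3 : ((v : Fin n → ℤ) ⬝ᵥ (w : Fin n → ℤ)) * ((v : Fin n → ℤ) ⬝ᵥ (w : Fin n → ℤ)) =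
        ((v : Fin n → ℤ) ⬝ᵥ (v : Fin n → ℤ)) * ((w : Fin n → ℤ) ⬝ᵥ (w : Fin n → ℤ)) := by
      have : ((((v : Fin n → ℤ) ⬝ᵥ (w : Fin n → ℤ) : ℤ)) : ℂ) *
          (((v : Fin n → ℤ) ⬝ᵥ (w : Fin n → ℤ) : ℤ)) =
          (((v : Fin n → ℤ) ⬝ᵥ (v : Fin n → ℤ) : ℤ)) *
            (((w : Fin n → ℤ) ⬝ᵥ (w : Fin n → ℤ) : ℤ)) := by
        rw [← h1, ← h2, ← h1]
      exact_mod_cast this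
    rcases h.reduced v v.2 w w.2 h3 with h4 | h4
    · exact Subtype.ext h4
    · exfalso
      rw [h4, neg_dotProduct] at h1
      push_cast at h1
      apply hw0'
      linear_combination (1 / 2 : ℂ) * h1

/-- The root pairing of an integer root system, in a vector space with coordinates `e`. -/
def rootPairing (h : IsIntegerRootSystem S α c C) (e : U ≃ₗ[ℂ] (Fin n → ℂ)) :
    RootPairing S ℂ U (Module.Dual ℂ U) :=
  haveI : Module.Finite ℂ U := Module.Finite.equiv e.symm
  RootPairing.mk'' (Module.Dual.eval ℂ U) (rootEmb S e) (corootEmb h e)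
    (fun v => by
      change corootForm (v : Fin n → ℤ) (e (e.symm (toC v))) = 2
      rw [LinearEquiv.apply_symm_apply]
      exact corootForm_self (h.self_ne_zero v v.2))
    (by
      rintro v - ⟨w, rfl⟩
      obtain ⟨⟨k, hk⟩, hS⟩ := h.reflect v v.2 w w.2
      have h0 := h.self_ne_zero v v.2
      rw [hk, Int.mul_ediv_cancel_left _ h0] at hS
      refine ⟨⟨_, hS⟩, ?_⟩
      apply e.injective
      have h0' : (((v : Fin n → ℤ) ⬝ᵥ (v : Fin n → ℤ) : ℤ) : ℂ) ≠ 0 := by exact_mod_cast h0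
      have hk' : (2 * ((w : Fin n → ℤ) ⬝ᵥ (v : Fin n → ℤ) : ℤ) : ℂ) =
        ((v : Fin n → ℤ) ⬝ᵥ (v : Fin n → ℤ) : ℤ) * k := by exact_mod_cast hk
      have hform : corootForm (v : Fin n → ℤ) (toC (w : Fin n → ℤ)) = k := by
        rw [corootForm_toC, hk', mul_div_cancel_left₀ _ h0']
      change e (e.symm (toC ((w : Fin n → ℤ) - k • (v : Fin n → ℤ)))) =
        e (e.symm (toC w) - corootForm (v : Fin n → ℤ) (e (e.symm (toC w))) • e.symm (toC v))
      simp only [map_sub, map_smul, LinearEquiv.apply_symm_apply, hform, toC_sub_smul])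
    (by
      refine top_unique ?_
      have hb := (linearIndependent_toC h.det_ne_zero).map' e.symm.toLinearMap
        (LinearMap.ker_eq_bot.2 e.symm.injective)
      rw [← hb.span_eq_top_of_card_eq_finrank' (by
        rw [Fintype.card_fin, e.finrank_eq, Module.finrank_fin_fun])]
      apply Submodule.span_mono
      rintro _ ⟨i, rfl⟩
      exact ⟨⟨α i, h.simple_mem i⟩, rfl⟩)

variable (h : IsIntegerRootSystem S α c C) (e : U ≃ₗ[ℂ] (Fin n → ℂ))

theorem rootPairing_root (v : S) : (rootPairing h e).root v = e.symm (toC v) := rfl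

theorem rootPairing_pairing (v w : S) :
    (rootPairing h e).pairing v w =
      2 * (((v : Fin n → ℤ) ⬝ᵥ (w : Fin n → ℤ) : ℤ) : ℂ) /
        (((w : Fin n → ℤ) ⬝ᵥ (w : Fin n → ℤ) : ℤ) : ℂ) := by
  rw [← corootForm_toC]
  change corootForm (w : Fin n → ℤ) (e (e.symm (toC v))) = _
  rw [LinearEquiv.apply_symm_apply]

theorem rootPairing_int (v w : S) : ∃ z : ℤ, (z : ℂ) = (rootPairing h e).pairing v w := by
  obtain ⟨⟨k, hk⟩, -⟩ := h.reflect w w.2 v v.2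
  refine ⟨k, ?_⟩
  have h0' : (((w : Fin n → ℤ) ⬝ᵥ (w : Fin n → ℤ) : ℤ) : ℂ) ≠ 0 := by
    exact_mod_cast h.self_ne_zero w w.2
  have hk' : (2 * ((v : Fin n → ℤ) ⬝ᵥ (w : Fin n → ℤ) : ℤ) : ℂ) =
        ((w : Fin n → ℤ) ⬝ᵥ (w : Fin n → ℤ) : ℤ) * k := by exact_mod_cast hk
  rw [rootPairing_pairing, hk', mul_div_cancel_left₀ _ h0']

instance rootPairing_isCrystallographic : (rootPairing h e).IsCrystallographic :=
  ⟨rootPairing_int h e⟩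

instance rootPairing_isRootSystem : (rootPairing h e).IsRootSystem :=
  haveI : Module.Finite ℂ U := Module.Finite.equiv e.symm
  RootPairing.isRootSystem_mk'' (rootPairing_int h e)

instance rootPairing_isReduced : (rootPairing h e).IsReduced where
  eq_or_eq_neg v w hvw := by
    have h1 : ¬ LinearIndependent ℂ ![toC (v : Fin n → ℤ), toC (w : Fin n → ℤ)] := by
      intro h2
      apply hvw
      have h3 := h2.map' e.symm.toLinearMap (LinearMap.ker_eq_bot.2 e.symm.injective)
      have h4 : ![(rootPairing h e).root v, (rootPairing h e).root w] =
          e.symm.toLinearMap ∘ ![toC (v : Fin n → ℤ), toC (w : Fin n → ℤ)] := by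
        ext i
        fin_cases i <;> rfl
      rw [h4]
      exact h3
    rcases h.reduced v v.2 w w.2 (gram_of_not_linearIndependent h1) with h4 | h4
    · left
      rw [Subtype.ext h4]
    · right
      rw [rootPairing_root, rootPairing_root, h4, ← map_neg]
      congr 1
      ext i
      simp [toC]

/-- The simple roots of an integer root system, as a function to the index type. -/
def simpleIdx (i : Fin n) : S := ⟨α i, h.simple_mem i⟩

theorem simpleIdx_injective : Function.Injective (simpleIdx h) := by
  intro i j hij
  apply (linearIndependent_toC h.det_ne_zero).injective
  exact congrArg toC (congrArg Subtype.val hij)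

theorem sum_smul_mem_closure {M : Type*} [AddCommGroup M] {s : Set M} {f : Fin n → M}
    (hf : ∀ i, f i ∈ s) {k : Fin n → ℤ} (hk : ∀ i, 0 ≤ k i) :
    ∑ i, k i • f i ∈ AddSubmonoid.closure s := by
  refine AddSubmonoid.sum_mem _ fun i _ => ?_
  obtain ⟨m, hm⟩ := Int.eq_ofNat_of_zero_le (hk i)
  rw [hm]
  simpa using AddSubmonoid.nsmul_mem _ (AddSubmonoid.subset_closure (hf i)) m

/-- The base of the root pairing of an integer root system. -/
def rootBase : (rootPairing h e).Base :=
  RootPairing.Base.mk' (rootPairing h e) (Set.range (simpleIdx h))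
    (by
      have hb := (linearIndependent_toC h.det_ne_zero).map' e.symm.toLinearMap
        (LinearMap.ker_eq_bot.2 e.symm.injective)
      exact (linearIndepOn_range_iff (simpleIdx_injective h) _).2 hb)
    (by
      intro v
      obtain ⟨h1, h2⟩ := h.combination v v.2
      have h3 : (rootPairing h e).root v =
          ∑ i, c v i • (rootPairing h e).root (simpleIdx h i) := by
        apply e.injective
        simp only [rootPairing_root, map_sum, map_zsmul, LinearEquiv.apply_symm_apply]
        ext j
        have h4 := congrFun h1 j
        simp only [Finset.sum_apply, Pi.smul_apply, smul_eq_mul] at h4 ⊢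
        simp only [toC, simpleIdx]
        rw [h4]
        simp
      have h5 : ∀ i, (rootPairing h e).root (simpleIdx h i) ∈
          (rootPairing h e).root '' Set.range (simpleIdx h) := fun i =>
        ⟨_, ⟨i, rfl⟩, rfl⟩
      rcases h2 with h2 | h2
      · left
        rw [h3]
        exact sum_smul_mem_closure h5 h2
      · right
        rw [h3, ← Finset.sum_neg_distrib]
        simp only [← neg_smul]
        exact sum_smul_mem_closure h5 fun i => neg_nonneg.2 (h2 i))

theorem mem_rootBase_support {v : S} : v ∈ (rootBase h e).support ↔ ∃ i, simpleIdx h i = v := by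
  simp [rootBase, RootPairing.Base.mk']

/-- The numbering of the base. -/
def rootBaseEquiv : (rootBase h e).support ≃ Fin n :=
  (Equiv.ofBijective (fun i => ⟨simpleIdx h i, (mem_rootBase_support h e).2 ⟨i, rfl⟩⟩)
    ⟨fun i j hij => simpleIdx_injective h (congrArg Subtype.val hij), fun ⟨v, hv⟩ => by
      obtain ⟨i, hi⟩ := (mem_rootBase_support h e).1 hv
      exact ⟨i, Subtype.ext hi⟩⟩).symm

theorem rootBase_cartanMatrix :
    (rootBase h e).cartanMatrix.reindex (rootBaseEquiv h e) (rootBaseEquiv h e) = C := by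
  ext i j
  rw [Matrix.reindex_apply, Matrix.submatrix_apply, RootPairing.Base.cartanMatrix,
    RootPairing.Base.cartanMatrixIn_def]
  change (rootPairing h e).pairingIn ℤ (simpleIdx h i) (simpleIdx h j) = C i j
  apply Int.cast_injective (α := ℂ)
  have h1 := (rootPairing h e).algebraMap_pairingIn ℤ (simpleIdx h i) (simpleIdx h j)
  rw [eq_intCast] at h1
  rw [h1, rootPairing_pairing]
  have h0 : ((α j ⬝ᵥ α j : ℤ) : ℂ) ≠ 0 := by
    exact_mod_cast h.self_ne_zero _ (h.simple_mem j)
  have h2 : (2 * ((α i ⬝ᵥ α j : ℤ)) : ℂ) = C i j * (α j ⬝ᵥ α j : ℤ) := by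
    exact_mod_cast h.cartan i j
  change 2 * ((α i ⬝ᵥ α j : ℤ) : ℂ) / ((α j ⬝ᵥ α j : ℤ) : ℂ) = _
  rw [h2, mul_div_cancel_right₀ _ h0]

theorem rootPairing_reflection_apply (v : S) (x : U) :
    e ((rootPairing h e).reflection v x) = refl (v : Fin n → ℤ) (e x) := by
  change e (x - corootForm (v : Fin n → ℤ) (e x) • e.symm (toC v)) = _
  rw [map_sub, map_smul, LinearEquiv.apply_symm_apply]
  rfl

/-- The reflection in an arbitrary root is a product of simple reflections. -/
theorem refl_mem_closure (h : IsIntegerRootSystem S α c C) (e : U ≃ₗ[ℂ] (Fin n → ℂ)) (v : S) :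
    refl (v : Fin n → ℤ) ∈ Submonoid.closure (Set.range fun i => refl (α i)) := by
  have key : ∀ v w : S, refl ((rootPairing h e).reflectionPerm w v : Fin n → ℤ) =
      refl (w : Fin n → ℤ) * refl (v : Fin n → ℤ) * refl (w : Fin n → ℤ) := by
    intro v w
    refine LinearMap.ext fun x => ?_
    obtain ⟨x, rfl⟩ := e.surjective x
    rw [Module.End.mul_apply, Module.End.mul_apply, ← rootPairing_reflection_apply h e,
      ← rootPairing_reflection_apply h e, ← rootPairing_reflection_apply h e,
      ← rootPairing_reflection_apply h e, RootPairing.reflection_reflectionPerm]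
    rfl
  refine (rootBase h e).induction_reflect v
    (p := fun v => refl (v : Fin n → ℤ) ∈ Submonoid.closure (Set.range fun i => refl (α i)))
    ?_ ?_ ?_
  · intro v hv
    rw [key]
    exact mul_mem (mul_mem hv hv) hv
  · intro v hv
    obtain ⟨i, rfl⟩ := (mem_rootBase_support h e).1 hv
    exact Submonoid.subset_closure ⟨i, rfl⟩
  · intro v w hv hw
    obtain ⟨i, rfl⟩ := (mem_rootBase_support h e).1 hw
    have hi : refl (α i) ∈ Submonoid.closure (Set.range fun i => refl (α i)) :=
      Submonoid.subset_closure ⟨i, rfl⟩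
    rw [key]
    exact mul_mem (mul_mem hi hv) hi

/-- A group acting faithfully, whose image in coordinates is generated by the simple reflections of
an integer root system, is the Weyl group of that root system. -/
theorem isWeylGroupOfType_of_mrange_eq (h : IsIntegerRootSystem S α c C)
    (e : U ≃ₗ[ℂ] (Fin n → ℂ)) {W : Type*} [Group W] (τ : W →* (U →ₗ[ℂ] U))
    (ρ : W →* Module.End ℂ (Fin n → ℂ)) (hρ : ∀ w x, e (τ w x) = ρ w (e x))
    (hinj : Function.Injective ρ)
    (hrange : MonoidHom.mrange ρ = Submonoid.closure (Set.range fun i => refl (α i))) :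
    IsWeylGroupOfType τ C := by
  have toW : ∀ g : (rootPairing h e).weylGroup, ∃ w, ∀ x : U, g • x = τ w x := by
    rintro ⟨g, hg⟩
    induction hg using RootPairing.weylGroup.induction with
    | mem v =>
      have h1 := refl_mem_closure h e v
      rw [← hrange] at h1
      obtain ⟨w, hw⟩ := h1
      refine ⟨w, fun x => e.injective ?_⟩
      rw [hρ, hw, ← rootPairing_reflection_apply h e]
      rfl
    | one => exact ⟨1, fun x => by simp⟩
    | mul x y hx hy h1 h2 =>
      obtain ⟨w1, hw1⟩ := h1
      obtain ⟨w2, hw2⟩ := h2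
      refine ⟨w1 * w2, fun z => ?_⟩
      rw [map_mul, Module.End.mul_apply, ← hw2, ← hw1]
      rfl
  have ofClosure : ∀ f ∈ Submonoid.closure (Set.range fun i => refl (α i)),
      ∃ g : (rootPairing h e).weylGroup, ∀ x : U, e (g • x) = f (e x) := by
    intro f hf
    induction hf using Submonoid.closure_induction with
    | mem f hf =>
      obtain ⟨i, rfl⟩ := hf
      refine ⟨RootPairing.weylGroup.ofIdx _ (simpleIdx h i), fun x => ?_⟩
      exact rootPairing_reflection_apply h e (simpleIdx h i) x
    | one => exact ⟨1, fun x => by simp⟩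
    | mul f₁ f₂ _ _ h1 h2 =>
      obtain ⟨g1, hg1⟩ := h1
      obtain ⟨g2, hg2⟩ := h2
      exact ⟨g1 * g2, fun x => by rw [mul_smul, hg1, hg2]; rfl⟩
  have ofW : ∀ w, ∃ g : (rootPairing h e).weylGroup, ∀ x : U, g • x = τ w x := by
    intro w
    obtain ⟨g, hg⟩ := ofClosure (ρ w) (hrange ▸ ⟨w, rfl⟩)
    exact ⟨g, fun x => e.injective (by rw [hg, hρ])⟩
  have faithful : ∀ g g' : (rootPairing h e).weylGroup, (∀ x : U, g • x = g' • x) → g = g' := by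
    intro g g' hgg
    exact Subtype.ext (RootPairing.Equiv.weightHom_injective _ (LinearEquiv.ext hgg))
  choose φ hφ using ofW
  let φ' : W →* (rootPairing h e).weylGroup := MonoidHom.mk' φ fun a b => by
    refine faithful _ _ fun x => ?_
    rw [hφ, mul_smul, hφ, hφ, map_mul]
    rfl
  have hbij : Function.Bijective φ' := by
    constructor
    · intro a b hab
      refine hinj (LinearMap.ext fun x => ?_)
      obtain ⟨x, rfl⟩ := e.surjective x
      rw [← hρ, ← hρ, ← hφ, ← hφ]
      change e (φ' a • x) = e (φ' b • x)
      rw [hab]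
    · intro g
      obtain ⟨w, hw⟩ := toW g
      exact ⟨w, faithful _ _ fun x => (hφ w x).trans (hw x).symm⟩
  exact ⟨S, inferInstance, rootPairing h e, inferInstance, inferInstance, inferInstance,
    rootBase h e, rootBaseEquiv h e, rootBase_cartanMatrix h e,
    MulEquiv.ofBijective φ' hbij, hφ⟩

end IntegerRoots

/-! ### The root systems of type `D₄` and `F₄` -/

/-- The base `e₀ - e₁, e₁ - e₂, e₂ - e₃, e₂ + e₃` of the root system of type `D₄`. -/
def simpleD : Fin 4 → Fin 4 → ℤ :=
  ![![1, -1, 0, 0], ![0, 1, -1, 0], ![0, 0, 1, -1], ![0, 0, 1, 1]]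

/-- The positive roots `e_i ± e_j`, `i < j`, of the root system of type `D₄`. -/
def posD : Finset (Fin 4 → ℤ) :=
  {![1, -1, 0, 0], ![1, 0, -1, 0], ![1, 0, 0, -1], ![0, 1, -1, 0], ![0, 1, 0, -1], ![0, 0, 1, -1],
   ![1, 1, 0, 0], ![1, 0, 1, 0], ![1, 0, 0, 1], ![0, 1, 1, 0], ![0, 1, 0, 1], ![0, 0, 1, 1]}

/-- The coefficients of a root of type `D₄` with respect to `simpleD`. -/
def coeffD (v : Fin 4 → ℤ) : Fin 4 → ℤ :=
  ![v 0, v 0 + v 1, (v 0 + v 1 + v 2 - v 3) / 2, (v 0 + v 1 + v 2 + v 3) / 2]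

/-- The base of the root system of type `F₄`, doubled in order to have integer coordinates: the long
roots `e₁ - e₃`, `e₃ - e₂` and the short roots `e₂`, `(e₀ - e₁ - e₂ - e₃) / 2`. -/
def simpleF : Fin 4 → Fin 4 → ℤ :=
  ![![0, 2, 0, -2], ![0, 0, -2, 2], ![0, 0, 2, 0], ![1, -1, -1, -1]]

/-- The positive roots of type `F₄`, doubled: the long roots `e_i ± e_j` and
the short roots `e_i` and `(e₀ ± e₁ ± e₂ ± e₃) / 2`. -/
def posF : Finset (Fin 4 → ℤ) :=
  {![2, -2, 0, 0], ![2, 0, -2, 0], ![2, 0, 0, -2], ![0, 2, -2, 0], ![0, 2, 0, -2], ![0, 0, -2, 2],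
   ![2, 2, 0, 0], ![2, 0, 2, 0], ![2, 0, 0, 2], ![0, 2, 2, 0], ![0, 2, 0, 2], ![0, 0, 2, 2],
   ![2, 0, 0, 0], ![0, 2, 0, 0], ![0, 0, 2, 0], ![0, 0, 0, 2],
   ![1, 1, 1, 1], ![1, 1, 1, -1], ![1, 1, -1, 1], ![1, 1, -1, -1],
   ![1, -1, 1, 1], ![1, -1, 1, -1], ![1, -1, -1, 1], ![1, -1, -1, -1]}

/-- The coefficients of a root of type `F₄` with respect to `simpleF`. -/
def coeffF (v : Fin 4 → ℤ) : Fin 4 → ℤ :=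
  ![(v 0 + v 1) / 2, (2 * v 0 + v 1 + v 3) / 2, (3 * v 0 + v 1 + v 2 + v 3) / 2, v 0]

/-- The conditions on an integer root system need only be verified on one root of each pair of
opposite roots. -/
theorem isIntegerRootSystem_of_half {n : ℕ} {H : Finset (Fin n → ℤ)} {α : Fin n → Fin n → ℤ}
    {c : (Fin n → ℤ) → Fin n → ℤ} {C : Matrix (Fin n) (Fin n) ℤ}
    (simple_mem : ∀ i, α i ∈ H) (self_ne_zero : ∀ v ∈ H, v ⬝ᵥ v ≠ 0)
    (reflect : ∀ v ∈ H, ∀ w ∈ H, (v ⬝ᵥ v) ∣ 2 * (w ⬝ᵥ v) ∧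
      (w - (2 * (w ⬝ᵥ v) / (v ⬝ᵥ v)) • v ∈ H ∨ -(w - (2 * (w ⬝ᵥ v) / (v ⬝ᵥ v)) • v) ∈ H))
    (reduced : ∀ v ∈ H, ∀ w ∈ H, (v ⬝ᵥ w) * (v ⬝ᵥ w) = (v ⬝ᵥ v) * (w ⬝ᵥ w) → v = w)
    (combination : ∀ v ∈ H, v = ∑ i, c v i • α i ∧ ∀ i, 0 ≤ c v i)
    (det_ne_zero : Matrix.det (Matrix.of α) ≠ 0)
    (cartan : ∀ i j, 2 * (α i ⬝ᵥ α j) = C i j * (α j ⬝ᵥ α j)) :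
    IsIntegerRootSystem (H ∪ H.image (-·)) α
      (fun v => if v ∈ H then c v else -c (-v)) C := by
  have cases : ∀ v ∈ H ∪ H.image (-·), ∃ u, u ∈ H ∧ (v = u ∨ v = -u) := by
    intro v hv
    rcases Finset.mem_union.1 hv with hv | hv
    · exact ⟨v, hv, Or.inl rfl⟩
    · obtain ⟨u, hu, rfl⟩ := Finset.mem_image.1 hv
      exact ⟨u, hu, Or.inr rfl⟩
  have mem : ∀ v, v ∈ H ∨ -v ∈ H → v ∈ H ∪ H.image (-·) := by
    rintro v (hv | hv)
    · exact Finset.mem_union_left _ hv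
    · exact Finset.mem_union_right _ (Finset.mem_image.2 ⟨-v, hv, neg_neg v⟩)
  refine ⟨fun i => mem _ (Or.inl (simple_mem i)), ?_, ?_, ?_, ?_, det_ne_zero, cartan⟩
  · intro v hv
    obtain ⟨u, hu, rfl | rfl⟩ := cases v hv <;> simpa using self_ne_zero _ hu
  · intro v hv w hw
    obtain ⟨a, ha, hv'⟩ := cases v hv
    obtain ⟨b, hb, hw'⟩ := cases w hw
    clear hv hw
    obtain ⟨⟨k, hk⟩, h⟩ := reflect a ha b hb
    rw [hk, Int.mul_ediv_cancel_left _ (self_ne_zero a ha)] at h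
    rcases hv' with rfl | rfl <;> rcases hw' with rfl | rfl <;>
      simp only [neg_dotProduct, dotProduct_neg, neg_neg, mul_neg, hk, dvd_neg, dvd_mul_right,
        true_and]
    · rw [Int.mul_ediv_cancel_left _ (self_ne_zero _ ha)]
      exact mem _ h
    · rw [← mul_neg, Int.mul_ediv_cancel_left _ (self_ne_zero _ ha)]
      refine mem _ (Or.symm ?_)
      convert h using 2 <;> module
    · rw [← mul_neg, Int.mul_ediv_cancel_left _ (self_ne_zero _ ha)]
      refine mem _ ?_
      convert h using 2 <;> module
    · rw [Int.mul_ediv_cancel_left _ (self_ne_zero _ ha)]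
      refine mem _ (Or.symm ?_)
      convert h using 2 <;> module
  · intro v hv w hw h
    obtain ⟨a, ha, hv'⟩ := cases v hv
    obtain ⟨b, hb, hw'⟩ := cases w hw
    have h' : a = b := by
      apply reduced a ha b hb
      rcases hv' with rfl | rfl <;> rcases hw' with rfl | rfl <;> simpa using h
    rcases hv' with rfl | rfl <;> rcases hw' with rfl | rfl <;> simp [h']
  · intro v hv
    by_cases hvH : v ∈ H
    · obtain ⟨h1, h2⟩ := combination v hvH
      simp only [if_pos hvH]
      exact ⟨h1, Or.inl h2⟩
    · obtain ⟨u, hu, rfl | rfl⟩ := cases v hv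
      · exact absurd hu hvH
      obtain ⟨h1, h2⟩ := combination u hu
      simp only [if_neg hvH, neg_neg, Pi.neg_apply, neg_smul, Finset.sum_neg_distrib, ← h1,
        true_and]
      exact Or.inr fun i => neg_nonpos.2 (h2 i)

theorem isIntegerRootSystem_D :
    IsIntegerRootSystem (posD ∪ posD.image (-·)) simpleD
      (fun v => if v ∈ posD then coeffD v else -coeffD (-v)) (CartanMatrix.D 4) := by
  apply isIntegerRootSystem_of_half <;> decide +kernel

theorem isIntegerRootSystem_F :
    IsIntegerRootSystem (posF ∪ posF.image (-·)) simpleF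
      (fun v => if v ∈ posF then coeffF v else -coeffF (-v)) CartanMatrix.F₄ := by
  apply isIntegerRootSystem_of_half <;> decide +kernel

/-! ### Signed permutations and the Weyl groups of type `D₄` and `F₄` -/

/-- The signed permutation of the coordinates `x ↦ (ε_i x_{π i})_i`. -/
def signedPerm (ε : Fin 4 → ℤˣ) (π : Equiv.Perm (Fin 4)) : Module.End ℂ (Fin 4 → ℂ) :=
  LinearMap.pi fun i => ((ε i : ℤ) : ℂ) • LinearMap.proj (π i)

theorem signedPerm_apply (ε : Fin 4 → ℤˣ) (π : Equiv.Perm (Fin 4)) (x : Fin 4 → ℂ) (i : Fin 4) :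
    signedPerm ε π x i = ((ε i : ℤ) : ℂ) * x (π i) := by
  simp [signedPerm]

theorem signedPerm_one : signedPerm 1 1 = 1 := by
  refine LinearMap.ext fun x => funext fun i => ?_
  simp [signedPerm_apply]

theorem signedPerm_mul (ε ε' : Fin 4 → ℤˣ) (π π' : Equiv.Perm (Fin 4)) :
    signedPerm ε π * signedPerm ε' π' = signedPerm (ε * ε' ∘ π) (π' * π) := by
  refine LinearMap.ext fun x => funext fun i => ?_
  rw [Module.End.mul_apply]
  simp only [signedPerm_apply, Equiv.Perm.mul_apply, Pi.mul_apply, Function.comp_apply]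
  push_cast
  ring

/-- A linear map which sends every basis vector to a multiple of a basis vector, and preserves the
sum of the squares and the product of the coordinates, is a signed permutation with an even number
of minus signs. -/
theorem exists_eq_signedPerm (M : Module.End ℂ (Fin 4 → ℂ))
    (h1 : ∀ j, ∃ k c, M (Pi.single j 1) = Pi.single k c)
    (h2 : ∀ x, ∑ i, M x i ^ 2 = ∑ i, x i ^ 2) (h3 : ∀ x, ∏ i, M x i = ∏ i, x i) :
    ∃ ε π, ∏ i, ε i = 1 ∧ M = signedPerm ε π := by
  choose p c hpc using h1
  have hM : ∀ x, M x = ∑ j, x j • Pi.single (p j) (c j) := by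
    intro x
    conv_lhs => rw [pi_eq_sum_univ' x]
    simp only [map_sum, map_smul]
    refine Finset.sum_congr rfl fun j _ => ?_
    rw [← hpc]
  have hsq : ∀ j, c j = 1 ∨ c j = -1 := by
    intro j
    have h := h2 (Pi.single j 1)
    rw [hpc] at h
    simp [Pi.single_apply, ite_pow] at h
    exact h
  -- Evaluating the product at the vector `(1, 1, 1, 1)` shows that `p` is surjective.
  have hsurj : Function.Surjective p := by
    intro k
    by_contra hk
    push Not at hk
    have h := h3 1
    rw [Finset.prod_eq_zero (Finset.mem_univ k)] at h
    · simp at h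
    · rw [hM]
      simp [Finset.sum_apply, fun j => (hk j).symm]
  have hbij : Function.Bijective p := Finite.surjective_iff_bijective.1 hsurj
  let π : Equiv.Perm (Fin 4) := (Equiv.ofBijective p hbij).symm
  have hπ : ∀ j, p (π j) = j := fun j => (Equiv.ofBijective p hbij).apply_symm_apply j
  have hπ' : ∀ i j, i = p j ↔ π i = j := fun i j =>
    ((Equiv.ofBijective p hbij).symm_apply_eq (x := i) (y := j)).symm
  have hε : ∀ i, ∃ u : ℤˣ, ((u : ℤ) : ℂ) = c (π i) := by
    intro i
    rcases hsq (π i) with h | h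
    · exact ⟨1, by simp [h]⟩
    · exact ⟨-1, by simp [h]⟩
  choose ε hε using hε
  have hMε : M = signedPerm ε π := by
    refine LinearMap.ext fun x => funext fun i => ?_
    rw [hM, signedPerm_apply, hε]
    simp [Finset.sum_apply, Pi.single_apply, hπ', mul_comm]
  refine ⟨ε, π, ?_, hMε⟩
  have h := h3 1
  rw [hMε] at h
  simp only [signedPerm_apply, Pi.one_apply, mul_one, Finset.prod_const_one] at h
  have h' : ((∏ i, ε i : ℤˣ) : ℤ) = 1 := by
    apply Int.cast_injective (α := ℂ)
    rw [← Units.coeHom_apply, map_prod]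
    push_cast
    exact h
  exact Units.ext h'

/-- The Weyl group of type `D₄`. -/
def weylD : Submonoid (Module.End ℂ (Fin 4 → ℂ)) :=
  Submonoid.closure (Set.range fun i => refl (simpleD i))

/-- The Weyl group of type `F₄`. -/
def weylF : Submonoid (Module.End ℂ (Fin 4 → ℂ)) :=
  Submonoid.closure (Set.range fun i => refl (simpleF i))

theorem refl_mem_weylD {v : Fin 4 → ℤ} (hv : v ∈ posD ∪ posD.image (-·)) : refl v ∈ weylD :=
  refl_mem_closure isIntegerRootSystem_D (LinearEquiv.refl ℂ (Fin 4 → ℂ)) ⟨v, hv⟩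

theorem refl_mem_weylF {v : Fin 4 → ℤ} (hv : v ∈ posF ∪ posF.image (-·)) : refl v ∈ weylF :=
  refl_mem_closure isIntegerRootSystem_F (LinearEquiv.refl ℂ (Fin 4 → ℂ)) ⟨v, hv⟩

theorem refl_smul {n : ℕ} (v : Fin n → ℤ) {k : ℤ} (hk : k ≠ 0) : refl (k • v) = refl v := by
  refine LinearMap.ext fun x => funext fun i => ?_
  have hk' : (k : ℂ) ≠ 0 := by exact_mod_cast hk
  simp only [refl_apply, smul_dotProduct, dotProduct_smul, smul_eq_mul, Pi.smul_apply]
  push_cast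
  simp only [mul_assoc, ← Finset.mul_sum]
  by_cases h0 : ((v ⬝ᵥ v : ℤ) : ℂ) = 0
  · simp [h0]
  · field_simp

theorem weylD_le_weylF : weylD ≤ weylF := by
  refine Submonoid.closure_le.2 ?_
  rintro _ ⟨i, rfl⟩
  change refl (simpleD i) ∈ weylF
  rw [← refl_smul (simpleD i) two_ne_zero]
  apply refl_mem_weylF
  revert i
  decide +kernel

/-- The reflections in `e_i - e_{i+1}` exchange two adjacent coordinates. -/
theorem refl_eq_swap (i : Fin 3) :
    refl (simpleD i.castSucc) = signedPerm 1 (Equiv.swap i.castSucc i.succ) := by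
  refine LinearMap.ext fun x => funext fun k => ?_
  rw [refl_apply, signedPerm_apply]
  fin_cases i <;> fin_cases k <;>
    simp [simpleD, dotProduct, Fin.sum_univ_four, Equiv.swap_apply_def]

theorem signedPerm_one_mem_weylD (π : Equiv.Perm (Fin 4)) : signedPerm 1 π ∈ weylD := by
  have hπ : π ∈ Submonoid.closure (Set.range fun i : Fin 3 => Equiv.swap i.castSucc i.succ) := by
    rw [Equiv.Perm.mclosure_swap_castSucc_succ]
    trivial
  induction hπ using Submonoid.closure_induction with
  | mem π hπ =>
    obtain ⟨i, rfl⟩ := hπ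
    rw [← refl_eq_swap]
    exact Submonoid.subset_closure ⟨_, rfl⟩
  | one => exact signedPerm_one ▸ one_mem _
  | mul π π' _ _ h h' =>
    have h2 : signedPerm 1 (π * π') = signedPerm 1 π' * signedPerm 1 π := by
      rw [signedPerm_mul]
      simp
    rw [h2]
    exact mul_mem h' h

/-- The change of two adjacent signs is the product of the commuting reflections in
`e_i - e_{i+1}` and `e_i + e_{i+1}`. -/
theorem signChange_mem_weylD :
    ∀ ε ∈ ({1, ![-1, -1, 1, 1], ![1, -1, -1, 1], ![1, 1, -1, -1]} : Finset (Fin 4 → ℤˣ)),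
      signedPerm ε 1 ∈ weylD := by
  intro ε hε
  simp only [Finset.mem_insert, Finset.mem_singleton] at hε
  rcases hε with rfl | rfl | rfl | rfl
  · exact signedPerm_one ▸ one_mem _
  · have h : signedPerm ![-1, -1, 1, 1] 1 = refl ![1, -1, 0, 0] * refl ![1, 1, 0, 0] := by
      refine LinearMap.ext fun x => funext fun k => ?_
      rw [Module.End.mul_apply, signedPerm_apply]
      fin_cases k <;> simp [refl_apply, dotProduct, Fin.sum_univ_four]
    rw [h]
    exact mul_mem (refl_mem_weylD (by decide +kernel)) (refl_mem_weylD (by decide +kernel))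
  · have h : signedPerm ![1, -1, -1, 1] 1 = refl ![0, 1, -1, 0] * refl ![0, 1, 1, 0] := by
      refine LinearMap.ext fun x => funext fun k => ?_
      rw [Module.End.mul_apply, signedPerm_apply]
      fin_cases k <;> simp [refl_apply, dotProduct, Fin.sum_univ_four]
    rw [h]
    exact mul_mem (refl_mem_weylD (by decide +kernel)) (refl_mem_weylD (by decide +kernel))
  · have h : signedPerm ![1, 1, -1, -1] 1 = refl ![0, 0, 1, -1] * refl ![0, 0, 1, 1] := by
      refine LinearMap.ext fun x => funext fun k => ?_
      rw [Module.End.mul_apply, signedPerm_apply]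
      fin_cases k <;> simp [refl_apply, dotProduct, Fin.sum_univ_four]
    rw [h]
    exact mul_mem (refl_mem_weylD (by decide +kernel)) (refl_mem_weylD (by decide +kernel))

theorem signedPerm_mem_weylD {ε : Fin 4 → ℤˣ} (hε : ∏ i, ε i = 1) (π : Equiv.Perm (Fin 4)) :
    signedPerm ε π ∈ weylD := by
  have hdec : ∀ ε : Fin 4 → ℤˣ, ∏ i, ε i = 1 →
      ∃ a ∈ ({1, ![-1, -1, 1, 1]} : Finset (Fin 4 → ℤˣ)),
      ∃ b ∈ ({1, ![1, -1, -1, 1]} : Finset (Fin 4 → ℤˣ)),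
      ∃ c ∈ ({1, ![1, 1, -1, -1]} : Finset (Fin 4 → ℤˣ)), ε = a * b * c := by
    decide +kernel
  obtain ⟨a, ha, b, hb, c, hc, rfl⟩ := hdec ε hε
  have h : signedPerm (a * b * c) π =
      signedPerm a 1 * signedPerm b 1 * signedPerm c 1 * signedPerm 1 π := by
    simp only [signedPerm_mul]
    congr 1
    ext i
    simp
  rw [h]
  refine mul_mem (mul_mem (mul_mem ?_ ?_) ?_) (signedPerm_one_mem_weylD π)
  · exact signChange_mem_weylD a (by clear h hε; revert a; decide)
  · exact signChange_mem_weylD b (by clear h hε; revert b; decide)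
  · exact signChange_mem_weylD c (by clear h hε; revert c; decide)

/-- The change of the sign of the coordinate `2`. -/
def reflShort : Module.End ℂ (Fin 4 → ℂ) := refl ![0, 0, 2, 0]

/-- The reflection in the hyperplane `x₀ = x₁ + x₂ + x₃`. -/
def reflHalf : Module.End ℂ (Fin 4 → ℂ) := refl ![1, -1, -1, -1]

theorem reflShort_apply (x : Fin 4 → ℂ) : reflShort x = ![x 0, x 1, -x 2, x 3] := by
  ext k
  rw [reflShort, refl_apply]
  fin_cases k <;> simp [dotProduct, Fin.sum_univ_four]
  ring

theorem reflHalf_apply (x : Fin 4 → ℂ) :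
    reflHalf x = (1 / 2 : ℂ) • ![x 0 + x 1 + x 2 + x 3, x 0 + x 1 - x 2 - x 3,
      x 0 - x 1 + x 2 - x 3, x 0 - x 1 - x 2 + x 3] := by
  ext k
  rw [reflHalf, refl_apply]
  fin_cases k <;> simp [dotProduct, Fin.sum_univ_four] <;> ring

theorem reflShort_mul_self : reflShort * reflShort = 1 := by
  refine LinearMap.ext fun x => funext fun k => ?_
  rw [Module.End.mul_apply]
  fin_cases k <;> simp [reflShort_apply]

theorem reflHalf_mul_self : reflHalf * reflHalf = 1 := by
  refine LinearMap.ext fun x => funext fun k => ?_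
  rw [Module.End.mul_apply]
  fin_cases k <;> simp [reflHalf_apply] <;> ring

theorem reflShort_braid :
    reflHalf * reflShort * reflHalf = reflShort * reflHalf * reflShort := by
  refine LinearMap.ext fun x => funext fun k => ?_
  simp only [Module.End.mul_apply]
  fin_cases k <;> simp [reflHalf_apply, reflShort_apply] <;> ring

theorem reflShort_eq_signedPerm : reflShort = signedPerm ![1, 1, -1, 1] 1 := by
  refine LinearMap.ext fun x => funext fun k => ?_
  rw [signedPerm_apply, reflShort_apply]
  fin_cases k <;> simp

theorem reflShort_mem_weylF : reflShort ∈ weylF := Submonoid.subset_closure ⟨2, rfl⟩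

theorem reflHalf_mem_weylF : reflHalf ∈ weylF := Submonoid.subset_closure ⟨3, rfl⟩

theorem signedPerm_mem_weylF (ε : Fin 4 → ℤˣ) (π : Equiv.Perm (Fin 4)) :
    signedPerm ε π ∈ weylF := by
  rcases Int.units_eq_one_or (∏ i, ε i) with h | h
  · exact weylD_le_weylF (signedPerm_mem_weylD h π)
  · have h1 : signedPerm ε π = reflShort * signedPerm (![1, 1, -1, 1] * ε) π := by
      rw [reflShort_eq_signedPerm, signedPerm_mul, mul_one]
      congr 1
      ext i
      fin_cases i <;> simp
    rw [h1]
    refine mul_mem reflShort_mem_weylF (weylD_le_weylF (signedPerm_mem_weylD ?_ π))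
    simp only [Pi.mul_apply, Finset.prod_mul_distrib, h]
    decide

/-- Representatives of the right cosets of the group of signed permutations in the Weyl group of
type `F₄`. -/
def cosetRep : Fin 3 → Module.End ℂ (Fin 4 → ℂ) := ![1, reflHalf, reflHalf * reflShort]

/-- By the braid relation, the group generated by the two reflections has only six elements. -/
theorem exists_eq_mul_cosetRep {p : Module.End ℂ (Fin 4 → ℂ)}
    (hp : p ∈ Submonoid.closure {reflShort, reflHalf}) :
    ∃ k, p = cosetRep k ∨ p = reflShort * cosetRep k := by
  have hs (x : Module.End ℂ (Fin 4 → ℂ)) : reflShort * (reflShort * x) = x := by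
    rw [← mul_assoc, reflShort_mul_self, one_mul]
  have hb : reflHalf * (reflShort * reflHalf) = reflShort * (reflHalf * reflShort) := by
    rw [← mul_assoc, reflShort_braid, mul_assoc]
  induction hp using Submonoid.closure_induction_right with
  | one => exact ⟨0, Or.inl rfl⟩
  | mul_right p _ g hg h =>
    obtain ⟨k, hk⟩ := h
    rcases hg with rfl | rfl <;> fin_cases k <;> rcases hk with rfl | rfl <;>
      simp only [cosetRep, Fin.zero_eta, Fin.mk_one, Fin.reduceFinMk, Matrix.cons_val, mul_assoc,
        mul_one, one_mul, reflShort_mul_self, reflHalf_mul_self, hb, hs]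
    · exact ⟨0, Or.inr (mul_one _).symm⟩
    · exact ⟨0, Or.inl rfl⟩
    · exact ⟨2, Or.inl rfl⟩
    · exact ⟨2, Or.inr rfl⟩
    · exact ⟨1, Or.inl rfl⟩
    · exact ⟨1, Or.inr rfl⟩
    · exact ⟨1, Or.inl rfl⟩
    · exact ⟨1, Or.inr rfl⟩
    · exact ⟨0, Or.inl rfl⟩
    · exact ⟨0, Or.inr (mul_one _).symm⟩
    · exact ⟨2, Or.inr rfl⟩
    · exact ⟨2, Or.inl rfl⟩

/-- The doubled matrices of the maps `cosetRep k`. -/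
def cosetMat : Fin 3 → Matrix (Fin 4) (Fin 4) ℤ :=
  ![!![2, 0, 0, 0; 0, 2, 0, 0; 0, 0, 2, 0; 0, 0, 0, 2],
    !![1, 1, 1, 1; 1, 1, -1, -1; 1, -1, 1, -1; 1, -1, -1, 1],
    !![1, 1, -1, 1; 1, 1, 1, -1; 1, -1, -1, -1; 1, -1, 1, 1]]

theorem two_mul_cosetRep_single (k : Fin 3) (i j : Fin 4) :
    2 * cosetRep k (Pi.single j 1) i = cosetMat k i j := by
  fin_cases k <;> fin_cases i <;> fin_cases j <;>
    simp [cosetRep, cosetMat, reflHalf_apply, reflShort_apply]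

theorem signedPerm_mul_cosetRep_injective :
    Function.Injective fun t : (Fin 4 → ℤˣ) × Equiv.Perm (Fin 4) × Fin 3 =>
      signedPerm t.1 t.2.1 * cosetRep t.2.2 := by
  -- Up to sign, the twelve rows of the three matrices are distinct.
  have hdec : ∀ (k k' : Fin 3) (i i' : Fin 4) (u u' : ℤˣ),
      (∀ j, (u : ℤ) * cosetMat k i j = u' * cosetMat k' i' j) → u = u' ∧ k = k' ∧ i = i' := by
    decide +kernel
  rintro ⟨ε, π, k⟩ ⟨ε', π', k'⟩ h
  have h1 : ∀ i, ε i = ε' i ∧ k = k' ∧ π i = π' i := by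
    intro i
    apply hdec
    intro j
    have h2 := congrFun (LinearMap.congr_fun h (Pi.single j 1)) i
    simp only [Module.End.mul_apply, signedPerm_apply] at h2
    apply Int.cast_injective (α := ℂ)
    push_cast
    rw [← two_mul_cosetRep_single, ← two_mul_cosetRep_single]
    linear_combination 2 * h2
  obtain rfl : ε = ε' := funext fun i => (h1 i).1
  obtain rfl : π = π' := Equiv.ext fun i => (h1 i).2.2
  rw [(h1 0).2.1]

theorem cosetRep_mem_weylF (k : Fin 3) : cosetRep k ∈ weylF := by
  fin_cases k
  · exact one_mem _
  · exact reflHalf_mem_weylF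
  · exact mul_mem reflHalf_mem_weylF reflShort_mem_weylF

theorem card_signedPerm_mul_cosetRep :
    Nat.card ((Fin 4 → ℤˣ) × Equiv.Perm (Fin 4) × Fin 3) = 1152 := by
  rw [Nat.card_eq_fintype_card]
  simp [Fintype.card_perm, Nat.factorial]

/-! ### Local operators in the basis given by `T` -/

theorem sqrt_two_inv_mul_self :
    (((Real.sqrt 2 : ℝ) : ℂ)⁻¹) * (((Real.sqrt 2 : ℝ) : ℂ)⁻¹) = 1 / 2 := by
  rw [← mul_inv, ← Complex.ofReal_mul, Real.mul_self_sqrt (by norm_num)]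
  norm_num

/-- The matrix `√2 T`. -/
def scaledT : Matrix (Fin 4) (Fin 4) ℂ :=
  !![1, 0, 0, 1; 0, Complex.I, Complex.I, 0; 0, -1, 1, 0; Complex.I, 0, 0, -Complex.I]

/-- The matrix `√2 T†`. -/
def scaledTH : Matrix (Fin 4) (Fin 4) ℂ :=
  !![1, 0, 0, -Complex.I; 0, -Complex.I, -1, 0; 0, -Complex.I, 1, 0; 1, 0, 0, Complex.I]

theorem Tmat_eq : Tmat = (((Real.sqrt 2 : ℝ) : ℂ)⁻¹) • scaledT := rfl

theorem Tmat_conjTranspose : Tmatᴴ = (((Real.sqrt 2 : ℝ) : ℂ)⁻¹) • scaledTH := by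
  rw [Tmat_eq, Matrix.conjTranspose_smul]
  congr 1
  · simp
  · ext i j
    fin_cases i <;> fin_cases j <;> simp [scaledT, scaledTH]

theorem Tmat_mul_mul (M : Matrix (Fin 4) (Fin 4) ℂ) :
    Tmat * M * Tmatᴴ = (1 / 2 : ℂ) • (scaledT * M * scaledTH) := by
  rw [Tmat_conjTranspose, Tmat_eq, ← sqrt_two_inv_mul_self, Matrix.smul_mul, Matrix.smul_mul,
    Matrix.mul_smul, smul_smul]

theorem Tmat_conjTranspose_mul_mul (M : Matrix (Fin 4) (Fin 4) ℂ) :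
    Tmatᴴ * M * Tmat = (1 / 2 : ℂ) • (scaledTH * M * scaledT) := by
  rw [Tmat_conjTranspose, Tmat_eq, ← sqrt_two_inv_mul_self, Matrix.smul_mul, Matrix.smul_mul,
    Matrix.mul_smul, smul_smul]

theorem Tmat_mul_conjTranspose : Tmat * Tmatᴴ = 1 := by
  have h := Tmat_mul_mul 1
  rw [mul_one, mul_one] at h
  rw [h]
  ext i j
  fin_cases i <;> fin_cases j <;>
    simp [scaledT, scaledTH] <;> norm_num

theorem Tmat_conjTranspose_mul : Tmatᴴ * Tmat = 1 :=
  mul_eq_one_comm.1 Tmat_mul_conjTranspose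

/-- The bijection of `{0, 1, 2, 3}` with the pairs of bits, in the order `00, 01, 10, 11`. -/
abbrev pairEquiv : Fin 4 ≃ Fin 2 × Fin 2 := (finProdFinEquiv (m := 2) (n := 2)).symm

/-- The Kronecker product of two `2 × 2` matrices, with the indices in the order
`00, 01, 10, 11`. -/
def kronMat (A B : Matrix (Fin 2) (Fin 2) ℂ) : Matrix (Fin 4) (Fin 4) ℂ :=
  (A ⊗ₖ B).submatrix pairEquiv pairEquiv

theorem kronMat_mul (A B A' B' : Matrix (Fin 2) (Fin 2) ℂ) :
    kronMat A B * kronMat A' B' = kronMat (A * A') (B * B') := by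
  rw [kronMat, kronMat, kronMat, Matrix.submatrix_mul_equiv, Matrix.mul_kronecker_mul]

theorem kronMat_transpose (A B : Matrix (Fin 2) (Fin 2) ℂ) :
    (kronMat A B)ᵀ = kronMat Aᵀ Bᵀ := rfl

theorem det_kronMat (A B : Matrix (Fin 2) (Fin 2) ℂ) :
    (kronMat A B).det = A.det ^ 2 * B.det ^ 2 := by
  rw [kronMat, Matrix.det_submatrix_equiv_self, Matrix.det_kronecker, Fintype.card_fin]

theorem kronMat_smul (r s : ℂ) (A B : Matrix (Fin 2) (Fin 2) ℂ) :
    kronMat (r • A) (s • B) = (r * s) • kronMat A B := by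
  rw [kronMat, Matrix.smul_kronecker, Matrix.kronecker_smul, smul_smul]
  rfl

theorem kronMat_of (a b c d a' b' c' d' : ℂ) :
    kronMat !![a, b; c, d] !![a', b'; c', d'] =
      !![a * a', a * b', b * a', b * b'; a * c', a * d', b * c', b * d';
         c * a', c * b', d * a', d * b'; c * c', c * d', d * c', d * d'] := by
  ext i j
  fin_cases i <;> fin_cases j <;> rfl

/-- The indices of the rows and columns of `tildeMat`. -/
def bitEquiv : (Fin 4 → Fin 2) ≃ Fin 4 × Fin 4 where
  toFun x := (pairEquiv.symm (x 0, x 1), pairEquiv.symm (x 2, x 3))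
  invFun rc :=
    ![(pairEquiv rc.1).1, (pairEquiv rc.1).2, (pairEquiv rc.2).1, (pairEquiv rc.2).2]
  left_inv := by decide
  right_inv := by decide

theorem tildeMat_apply (ψ : State) (r c : Fin 4) : tildeMat ψ r c = ψ (bitEquiv.symm (r, c)) := rfl

theorem tildeMat_localOp (A : SLloc) (ψ : State) :
    tildeMat (localOp A ψ) = kronMat (A 0) (A 1) * tildeMat ψ * kronMat (A 2)ᵀ (A 3)ᵀ := by
  ext r c
  rw [tildeMat_apply, localOp_apply, ← bitEquiv.symm.sum_comp, Fintype.sum_prod_type,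
    Matrix.mul_apply, Finset.sum_comm]
  refine Finset.sum_congr rfl fun c' _ => ?_
  rw [Matrix.mul_apply, Finset.sum_mul]
  refine Finset.sum_congr rfl fun r' _ => ?_
  rw [Fin.prod_univ_four, tildeMat_apply]
  change A 0 (pairEquiv r).1 (pairEquiv r').1 * A 1 (pairEquiv r).2 (pairEquiv r').2 *
      A 2 (pairEquiv c).1 (pairEquiv c').1 * A 3 (pairEquiv c).2 (pairEquiv c').2 * _ =
    (A 0 (pairEquiv r).1 (pairEquiv r').1 * A 1 (pairEquiv r).2 (pairEquiv r').2) * _ *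
      (A 2 (pairEquiv c).1 (pairEquiv c').1 * A 3 (pairEquiv c).2 (pairEquiv c').2)
  ring

/-- The operator `A ⊗ B` in the basis given by `T`. -/
def orthMat (A B : Matrix (Fin 2) (Fin 2) ℂ) : Matrix (Fin 4) (Fin 4) ℂ :=
  Tmat * kronMat A B * Tmatᴴ

theorem Rmat_localOp (A : SLloc) (ψ : State) :
    Rmat (localOp A ψ) = orthMat (A 0) (A 1) * Rmat ψ * orthMat (A 2)ᵀ (A 3)ᵀ := by
  have h (M : Matrix (Fin 4) (Fin 4) ℂ) : Tmatᴴ * (Tmat * M) = M := by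
    rw [← mul_assoc, Tmat_conjTranspose_mul, one_mul]
  simp only [Rmat, orthMat, tildeMat_localOp, mul_assoc, h]

theorem det_orthMat {A B : Matrix (Fin 2) (Fin 2) ℂ} (hA : A.det = 1) (hB : B.det = 1) :
    (orthMat A B).det = 1 := by
  rw [orthMat, Matrix.det_mul, Matrix.det_mul, mul_right_comm, ← Matrix.det_mul,
    Tmat_mul_conjTranspose, det_kronMat, hA, hB]
  simp

/-- The matrices of determinant `1` preserve the standard alternating form. -/
theorem transpose_mul_alternating_mul {A : Matrix (Fin 2) (Fin 2) ℂ} (hA : A.det = 1) :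
    Aᵀ * !![0, 1; -1, 0] * A = !![0, 1; -1, 0] := by
  rw [Matrix.det_fin_two] at hA
  ext i j
  fin_cases i <;> fin_cases j <;>
    simp [Matrix.mul_apply, Fin.sum_univ_two] <;> first | ring1 | linear_combination hA |
      linear_combination -hA

/-- The matrix `T` turns the tensor square of the alternating form into the standard symmetric
bilinear form. -/
theorem Tmat_transpose_mul : Tmatᵀ * Tmat = kronMat !![0, 1; -1, 0] !![0, 1; -1, 0] := by
  rw [kronMat_of, Tmat_eq, Matrix.transpose_smul, Matrix.smul_mul, Matrix.mul_smul, smul_smul,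
    sqrt_two_inv_mul_self]
  ext i j
  fin_cases i <;> fin_cases j <;>
    simp [scaledT, Matrix.mul_apply, Fin.sum_univ_four] <;> norm_num

theorem orthMat_transpose_mul_self {A B : Matrix (Fin 2) (Fin 2) ℂ} (hA : A.det = 1)
    (hB : B.det = 1) : (orthMat A B)ᵀ * orthMat A B = 1 := by
  have h1 : (kronMat A B)ᵀ * (Tmatᵀ * Tmat) * kronMat A B = Tmatᵀ * Tmat := by
    rw [Tmat_transpose_mul, kronMat_transpose, kronMat_mul, kronMat_mul,
      transpose_mul_alternating_mul hA, transpose_mul_alternating_mul hB]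
  have h2 : Tmatᴴᵀ * Tmatᵀ = 1 := by
    rw [← Matrix.transpose_mul, Tmat_mul_conjTranspose, Matrix.transpose_one]
  calc (orthMat A B)ᵀ * orthMat A B
      = Tmatᴴᵀ * ((kronMat A B)ᵀ * (Tmatᵀ * Tmat) * kronMat A B) * Tmatᴴ := by
        simp only [orthMat, Matrix.transpose_mul, mul_assoc]
    _ = (Tmatᴴᵀ * Tmatᵀ) * (Tmat * Tmatᴴ) := by
        rw [h1]
        simp only [mul_assoc]
    _ = 1 := by rw [h2, Tmat_mul_conjTranspose, one_mul]

/-- If two matrices `O₁`, `O₂` in the special orthogonal group transform diagonal matrices `D` into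
diagonal matrices `O₁ D O₂`, then this is an even signed permutation of the diagonal entries: the
rank, the trace of `DᵀD` and the determinant are preserved. -/
theorem exists_eq_signedPerm_of_orthogonal {O₁ O₂ : Matrix (Fin 4) (Fin 4) ℂ}
    (h₁ : O₁ᵀ * O₁ = 1) (h₂ : O₂ᵀ * O₂ = 1) (d₁ : O₁.det = 1) (d₂ : O₂.det = 1)
    (M : Module.End ℂ (Fin 4 → ℂ))
    (hM : ∀ d, Matrix.diagonal (M d) = O₁ * Matrix.diagonal d * O₂) :
    ∃ ε π, ∏ i, ε i = 1 ∧ M = signedPerm ε π := by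
  apply exists_eq_signedPerm
  · intro j
    have hentry : ∀ i k, Matrix.diagonal (M (Pi.single j 1)) i k = O₁ i j * O₂ j k := by
      intro i k
      rw [hM, Matrix.mul_apply, Finset.sum_eq_single j]
      · rw [Matrix.mul_diagonal, Pi.single_eq_same, mul_one]
      · intro l _ hl
        rw [Matrix.mul_diagonal, Pi.single_eq_of_ne hl, mul_zero, zero_mul]
      · simp
    obtain ⟨k, hk⟩ : ∃ k, O₁ k j ≠ 0 := by
      by_contra! h
      have h' := congrFun (congrFun h₁ j) j
      simp [Matrix.mul_apply, h] at h'
    refine ⟨k, M (Pi.single j 1) k, funext fun l => ?_⟩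
    rcases eq_or_ne l k with rfl | hl
    · rw [Pi.single_eq_same]
    · rw [Pi.single_eq_of_ne hl]
      have h3 := hentry k l
      rw [Matrix.diagonal_apply_ne' _ hl] at h3
      have h4 := hentry l l
      rw [Matrix.diagonal_apply_eq] at h4
      rw [h4, (mul_eq_zero.1 h3.symm).resolve_left hk, mul_zero]
  · intro d
    have htr : ∀ d : Fin 4 → ℂ,
        ∑ i, d i ^ 2 = ((Matrix.diagonal d)ᵀ * Matrix.diagonal d).trace := by
      intro d
      rw [Matrix.diagonal_transpose, Matrix.diagonal_mul_diagonal, Matrix.trace_diagonal]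
      simp only [sq]
    have h₂' : O₂ * O₂ᵀ = 1 := mul_eq_one_comm.1 h₂
    rw [htr, htr, hM]
    calc ((O₁ * Matrix.diagonal d * O₂)ᵀ * (O₁ * Matrix.diagonal d * O₂)).trace
        = (O₂ᵀ * ((Matrix.diagonal d)ᵀ * (O₁ᵀ * O₁) * Matrix.diagonal d * O₂)).trace := by
          simp only [Matrix.transpose_mul, mul_assoc]
      _ = ((Matrix.diagonal d)ᵀ * Matrix.diagonal d).trace := by
          rw [Matrix.trace_mul_comm, h₁, mul_one, mul_assoc, h₂', mul_one]
  · intro d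
    rw [← Matrix.det_diagonal, hM, Matrix.det_mul, Matrix.det_mul, d₁, d₂, one_mul, mul_one,
      Matrix.det_diagonal]

/-! ### Coordinates on the Cartan subspace -/

/-- The matrix `ψ̃` of the tensor `ψ` in the Cartan subspace with the coordinates `d`. -/
def cartanMat (d : Fin 4 → ℂ) : Matrix (Fin 4) (Fin 4) ℂ :=
  (1 / 2 : ℂ) • !![d 0 + d 3, 0, 0, d 0 - d 3; 0, d 1 + d 2, d 1 - d 2, 0;
    0, d 1 - d 2, d 1 + d 2, 0; d 0 - d 3, 0, 0, d 0 + d 3]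

theorem Tmat_conjTranspose_mul_diagonal_mul (d : Fin 4 → ℂ) :
    Tmatᴴ * Matrix.diagonal d * Tmat = cartanMat d := by
  rw [Tmat_conjTranspose_mul_mul, cartanMat]
  congr 1
  ext i j
  have hI : Complex.I * Complex.I = -1 := Complex.I_mul_I
  fin_cases i <;> fin_cases j <;>
    simp [scaledT, scaledTH, Matrix.mul_apply, Fin.sum_univ_four, Matrix.vecMul_diagonal] <;>
    first | ring1 | linear_combination (-d 3) * hI | linear_combination (d 3) * hI |
      linear_combination (-d 1) * hI

/-- The tensor in the Cartan subspace with the coordinates `d`. -/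
def cartanState (d : Fin 4 → ℂ) : State := fun x => cartanMat d (bitEquiv x).1 (bitEquiv x).2

theorem tildeMat_cartanState (d : Fin 4 → ℂ) : tildeMat (cartanState d) = cartanMat d := by
  ext r c
  rw [tildeMat_apply, cartanState, Equiv.apply_symm_apply]

theorem Rmat_cartanState (d : Fin 4 → ℂ) : Rmat (cartanState d) = Matrix.diagonal d := by
  rw [Rmat, tildeMat_cartanState, ← Tmat_conjTranspose_mul_diagonal_mul, mul_assoc, mul_assoc,
    Tmat_mul_conjTranspose, mul_one, ← mul_assoc, Tmat_mul_conjTranspose, one_mul]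

theorem Rmat_injective : Function.Injective Rmat := by
  intro ψ φ h
  have h1 : tildeMat ψ = tildeMat φ := by
    have h2 := congrArg (fun M => Tmatᴴ * M * Tmat) h
    simp only [Rmat] at h2
    have h3 (M : Matrix (Fin 4) (Fin 4) ℂ) : Tmatᴴ * (Tmat * M * Tmatᴴ) * Tmat = M := by
      rw [mul_assoc, mul_assoc, Tmat_conjTranspose_mul, mul_one, ← mul_assoc,
        Tmat_conjTranspose_mul, one_mul]
    rwa [h3, h3] at h2
  funext x
  have h4 := congrFun (congrFun h1 (bitEquiv x).1) (bitEquiv x).2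
  rwa [tildeMat_apply, tildeMat_apply, Prod.mk.eta, Equiv.symm_apply_apply] at h4

theorem cartanState_mem (d : Fin 4 → ℂ) : cartanState d ∈ cartan := by
  change (Rmat (cartanState d)).IsDiag
  rw [Rmat_cartanState]
  exact Matrix.isDiag_diagonal d

/-- The coordinates `(a, b, c, d)` on the Cartan subspace. -/
def coord : cartan ≃ₗ[ℂ] (Fin 4 → ℂ) where
  toFun x := (Rmat x).diag
  map_add' x y := by rw [Submodule.coe_add, Rmat_add, Matrix.diag_add]
  map_smul' c x := by rw [Submodule.coe_smul, Rmat_smul, Matrix.diag_smul]; rfl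
  invFun d := ⟨cartanState d, cartanState_mem d⟩
  left_inv x := Subtype.ext (Rmat_injective (by
    rw [Rmat_cartanState]
    exact x.2.diagonal_diag))
  right_inv d := by
    change (Rmat (cartanState d)).diag = d
    rw [Rmat_cartanState, Matrix.diag_diagonal]

theorem Rmat_eq_diagonal_coord (x : cartan) : Rmat x = Matrix.diagonal (coord x) :=
  x.2.diagonal_diag.symm

theorem coord_of_Rmat_eq {x : cartan} {d : Fin 4 → ℂ} (h : Rmat x = Matrix.diagonal d) :
    coord x = d := by
  change (Rmat x).diag = d
  rw [h, Matrix.diag_diagonal]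

theorem eq_cartanState (x : cartan) : (x : State) = cartanState (coord x) :=
  congrArg Subtype.val (coord.symm_apply_apply x).symm

/-! ### The induced groups in coordinates -/

section Induced

variable {G V : Type*} [Group G] [AddCommGroup V] [Module ℂ V]

theorem inducedAction_mk (ρ : G →* (V ≃ₗ[ℂ] V)) (U : Submodule ℂ V) (g : setStab ρ U) (x : U) :
    (inducedAction ρ U (QuotientGroup.mk g) x : V) = ρ g x := rfl

theorem inducedAction_injective (ρ : G →* (V ≃ₗ[ℂ] V)) (U : Submodule ℂ V) :
    Function.Injective (inducedAction ρ U) := by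
  rw [injective_iff_map_eq_one]
  intro w hw
  obtain ⟨g, rfl⟩ := QuotientGroup.mk_surjective w
  refine (QuotientGroup.eq_one_iff g).2 fun x hx => ?_
  have h := congrArg Subtype.val (LinearMap.congr_fun hw ⟨x, hx⟩)
  rwa [inducedAction_mk] at h

theorem inducedAction_inducedMap {K : Type*} [Group K] (f : K →* G) (ρ : G →* (V ≃ₗ[ℂ] V))
    (U : Submodule ℂ V) (w : InducedGroup (ρ.comp f) U) :
    inducedAction ρ U (inducedMap f ρ U w) = inducedAction (ρ.comp f) U w := by
  obtain ⟨g, rfl⟩ := QuotientGroup.mk_surjective w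
  rfl

/-- In finite dimension, a subspace mapped into itself by an invertible operator is mapped onto
itself. -/
theorem mem_setStab_of_forall_mem [FiniteDimensional ℂ V] {ρ : G →* (V ≃ₗ[ℂ] V)}
    {U : Submodule ℂ V} {g : G} (h : ∀ x ∈ U, ρ g x ∈ U) : g ∈ setStab ρ U :=
  Submodule.eq_of_le_of_finrank_eq (Submodule.map_le_iff_le_comap.2 h)
    (LinearEquiv.finrank_map_eq (ρ g) U)

end Induced

/-- The action of `W_𝔞^*` on the coordinates `(a, b, c, d)`. -/
def starRep : Wstar →* Module.End ℂ (Fin 4 → ℂ) :=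
  coord.conjRingEquiv.toMonoidHom.comp WstarAction

/-- The action of `W_𝔞` on the coordinates `(a, b, c, d)`. -/
def locRep : Wloc →* Module.End ℂ (Fin 4 → ℂ) :=
  coord.conjRingEquiv.toMonoidHom.comp WlocAction

theorem coord_WstarAction (w : Wstar) (x : cartan) :
    coord (WstarAction w x) = starRep w (coord x) := by
  change _ = coord (WstarAction w (coord.symm (coord x)))
  rw [LinearEquiv.symm_apply_apply]

theorem coord_WlocAction (w : Wloc) (x : cartan) :
    coord (WlocAction w x) = locRep w (coord x) := by
  change _ = coord (WlocAction w (coord.symm (coord x)))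
  rw [LinearEquiv.symm_apply_apply]

theorem starRep_injective : Function.Injective starRep :=
  coord.conjRingEquiv.injective.comp (inducedAction_injective _ _)

theorem locRep_injective : Function.Injective locRep :=
  coord.conjRingEquiv.injective.comp (inducedAction_injective _ _)

theorem starRep_WlocToWstar (w : Wloc) : starRep (WlocToWstar w) = locRep w :=
  congrArg coord.conjRingEquiv (inducedAction_inducedMap locIncl starAction cartan w)

theorem WlocToWstar_injective : Function.Injective WlocToWstar := by
  intro w w' h
  apply locRep_injective
  rw [← starRep_WlocToWstar, ← starRep_WlocToWstar, h]

/-- An element of `SL_loc · Sym₄` which acts by the linear map `M` in the coordinates on the Cartan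
subspace stabilizes the Cartan subspace. -/
theorem mem_Nstar {g : SLlocStar} {M : Module.End ℂ (Fin 4 → ℂ)}
    (h : ∀ d, Rmat (starAction g (cartanState d)) = Matrix.diagonal (M d)) : g ∈ Nstar := by
  refine mem_setStab_of_forall_mem fun x hx => ?_
  change (Rmat (starAction g ((⟨x, hx⟩ : cartan) : State))).IsDiag
  rw [eq_cartanState ⟨x, hx⟩, h]
  exact Matrix.isDiag_diagonal _

theorem starRep_mk {g : SLlocStar} {M : Module.End ℂ (Fin 4 → ℂ)} (hg : g ∈ Nstar)
    (h : ∀ d, Rmat (starAction g (cartanState d)) = Matrix.diagonal (M d)) :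
    starRep (QuotientGroup.mk ⟨g, hg⟩) = M := by
  refine LinearMap.ext fun d => ?_
  rw [← coord.apply_symm_apply d, ← coord_WstarAction]
  apply coord_of_Rmat_eq
  rw [inducedAction_mk, eq_cartanState (coord.symm d), LinearEquiv.apply_symm_apply]
  exact h d

/-! ### The local operators -/

theorem locRep_eq_signedPerm (w : Wloc) :
    ∃ ε π, ∏ i, ε i = 1 ∧ locRep w = signedPerm ε π := by
  obtain ⟨⟨A, hA⟩, rfl⟩ := QuotientGroup.mk_surjective w
  have hdet (k : Fin 4) : ((A k : Matrix (Fin 2) (Fin 2) ℂ)ᵀ).det = 1 := by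
    rw [Matrix.det_transpose, (A k).2]
  exact exists_eq_signedPerm_of_orthogonal
    (orthMat_transpose_mul_self (A 0).2 (A 1).2) (orthMat_transpose_mul_self (hdet 2) (hdet 3))
    (det_orthMat (A 0).2 (A 1).2) (det_orthMat (hdet 2) (hdet 3))
    (locRep (QuotientGroup.mk ⟨A, hA⟩)) (by
      intro d
      rw [← Rmat_cartanState d, ← Rmat_localOp, ← coord.apply_symm_apply d, ← coord_WlocAction,
        ← Rmat_eq_diagonal_coord, inducedAction_mk, eq_cartanState (coord.symm d),
        LinearEquiv.apply_symm_apply]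
      rfl)

theorem locRep_mem_weylD (w : Wloc) : locRep w ∈ weylD := by
  obtain ⟨ε, π, hε, h⟩ := locRep_eq_signedPerm w
  rw [h]
  exact signedPerm_mem_weylD hε π

/-- The element of `SL₂(ℂ)` obtained from a matrix of determinant `2`. -/
def slOfDet (A : Matrix (Fin 2) (Fin 2) ℂ) (h : A.det = 2) :
    Matrix.SpecialLinearGroup (Fin 2) ℂ :=
  ⟨(((Real.sqrt 2 : ℝ) : ℂ)⁻¹) • A, by
    rw [Matrix.det_smul, Fintype.card_fin, sq, sqrt_two_inv_mul_self, h]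
    norm_num⟩

theorem orthMat_slOfDet {A B : Matrix (Fin 2) (Fin 2) ℂ} (hA : A.det = 2) (hB : B.det = 2) :
    orthMat (slOfDet A hA) (slOfDet B hB) =
      (1 / 4 : ℂ) • (scaledT * kronMat A B * scaledTH) := by
  simp only [slOfDet]
  rw [orthMat, kronMat_smul, Tmat_mul_mul, sqrt_two_inv_mul_self, Matrix.mul_smul,
    Matrix.smul_mul, smul_smul]
  norm_num

theorem slOfDet_transpose {A : Matrix (Fin 2) (Fin 2) ℂ} (hA : A.det = 2) (hA' : Aᵀ = A) :
    (slOfDet A hA : Matrix (Fin 2) (Fin 2) ℂ)ᵀ = slOfDet A hA := by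
  simp only [slOfDet]
  rw [Matrix.transpose_smul, hA']

/-- The element `(1 + i X) / √2` of `SL₂(ℂ)`, where `X` is the first Pauli matrix. -/
def rotX : Matrix.SpecialLinearGroup (Fin 2) ℂ :=
  slOfDet !![1, Complex.I; Complex.I, 1] (by
    rw [Matrix.det_fin_two_of]
    linear_combination -Complex.I_mul_I)

/-- The element `(1 - i X) / √2` of `SL₂(ℂ)`, the inverse of `rotX`. -/
def rotX' : Matrix.SpecialLinearGroup (Fin 2) ℂ :=
  slOfDet !![1, -Complex.I; -Complex.I, 1] (by
    rw [Matrix.det_fin_two_of]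
    linear_combination -Complex.I_mul_I)

/-- The element `(1 + i Z) / √2` of `SL₂(ℂ)`, where `Z` is the third Pauli matrix. -/
def rotZ : Matrix.SpecialLinearGroup (Fin 2) ℂ :=
  slOfDet !![1 + Complex.I, 0; 0, 1 - Complex.I] (by
    rw [Matrix.det_fin_two_of]
    linear_combination -Complex.I_mul_I)

/-- The element `(1 - i Z) / √2` of `SL₂(ℂ)`, the inverse of `rotZ`. -/
def rotZ' : Matrix.SpecialLinearGroup (Fin 2) ℂ :=
  slOfDet !![1 - Complex.I, 0; 0, 1 + Complex.I] (by
    rw [Matrix.det_fin_two_of]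
    linear_combination -Complex.I_mul_I)

theorem rotX_transpose : (rotX : Matrix (Fin 2) (Fin 2) ℂ)ᵀ = rotX :=
  slOfDet_transpose _ (by ext i j; fin_cases i <;> fin_cases j <;> rfl)

theorem rotX'_transpose : (rotX' : Matrix (Fin 2) (Fin 2) ℂ)ᵀ = rotX' :=
  slOfDet_transpose _ (by ext i j; fin_cases i <;> fin_cases j <;> rfl)

theorem rotZ_transpose : (rotZ : Matrix (Fin 2) (Fin 2) ℂ)ᵀ = rotZ :=
  slOfDet_transpose _ (by ext i j; fin_cases i <;> fin_cases j <;> rfl)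

theorem rotZ'_transpose : (rotZ' : Matrix (Fin 2) (Fin 2) ℂ)ᵀ = rotZ' :=
  slOfDet_transpose _ (by ext i j; fin_cases i <;> fin_cases j <;> rfl)

theorem orthMat_rotX_rotX :
    orthMat rotX rotX = !![0, 1, 0, 0; -1, 0, 0, 0; 0, 0, 1, 0; 0, 0, 0, 1] := by
  rw [rotX, orthMat_slOfDet, kronMat_of]
  ext i j
  fin_cases i <;> fin_cases j <;>
    simp [scaledT, scaledTH] <;> ring_nf <;> simp [Complex.I_sq]

theorem orthMat_rotX'_rotX' :
    orthMat rotX' rotX' = !![0, -1, 0, 0; 1, 0, 0, 0; 0, 0, 1, 0; 0, 0, 0, 1] := by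
  rw [rotX', orthMat_slOfDet, kronMat_of]
  ext i j
  fin_cases i <;> fin_cases j <;>
    simp [scaledT, scaledTH] <;> ring_nf <;> simp [Complex.I_sq]

theorem orthMat_rotX_rotX' :
    orthMat rotX rotX' = !![1, 0, 0, 0; 0, 1, 0, 0; 0, 0, 0, 1; 0, 0, -1, 0] := by
  rw [rotX, rotX', orthMat_slOfDet, kronMat_of]
  ext i j
  fin_cases i <;> fin_cases j <;>
    simp [scaledT, scaledTH] <;> ring_nf <;> simp [Complex.I_sq]

theorem orthMat_rotX'_rotX :
    orthMat rotX' rotX = !![1, 0, 0, 0; 0, 1, 0, 0; 0, 0, 0, -1; 0, 0, 1, 0] := by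
  rw [rotX, rotX', orthMat_slOfDet, kronMat_of]
  ext i j
  fin_cases i <;> fin_cases j <;>
    simp [scaledT, scaledTH] <;> ring_nf <;> simp [Complex.I_sq]

theorem orthMat_rotZ_rotZ' :
    orthMat rotZ rotZ' = !![1, 0, 0, 0; 0, 0, 1, 0; 0, -1, 0, 0; 0, 0, 0, 1] := by
  rw [rotZ, rotZ', orthMat_slOfDet, kronMat_of]
  ext i j
  fin_cases i <;> fin_cases j <;>
    simp [scaledT, scaledTH] <;> ring_nf <;> simp [Complex.I_sq] <;> norm_num

theorem orthMat_rotZ'_rotZ :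
    orthMat rotZ' rotZ = !![1, 0, 0, 0; 0, 0, -1, 0; 0, 1, 0, 0; 0, 0, 0, 1] := by
  rw [rotZ, rotZ', orthMat_slOfDet, kronMat_of]
  ext i j
  fin_cases i <;> fin_cases j <;>
    simp [scaledT, scaledTH] <;> ring_nf <;> simp [Complex.I_sq] <;> norm_num

/-- The simple reflections of type `D₄` are induced by local operators. With the rotation `O` by a
right angle in the plane of `e_i` and `e_{i+1}`, the reflection in `e_i - e_{i+1}` is
`D ↦ O D O⁻¹` and the reflection in `e_i + e_{i+1}` is `D ↦ O D O`. -/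
theorem exists_localOp_eq_refl (i : Fin 4) : ∃ A : SLloc, ∀ d,
    Rmat (localOp A (cartanState d)) = Matrix.diagonal (refl (simpleD i) d) := by
  refine ⟨(![![rotX, rotX, rotX', rotX'], ![rotZ, rotZ', rotZ', rotZ], ![rotX, rotX', rotX', rotX],
    ![rotX, rotX', rotX, rotX']] : Fin 4 → SLloc) i, fun d => ?_⟩
  rw [Rmat_localOp, Rmat_cartanState]
  fin_cases i <;>
    simp only [Fin.zero_eta, Fin.mk_one, Fin.reduceFinMk, Matrix.cons_val, rotX_transpose,
      rotX'_transpose, rotZ_transpose, rotZ'_transpose, orthMat_rotX_rotX, orthMat_rotX'_rotX',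
      orthMat_rotX_rotX', orthMat_rotX'_rotX, orthMat_rotZ_rotZ', orthMat_rotZ'_rotZ] <;>
    ext j k <;> fin_cases j <;> fin_cases k <;>
    simp [refl_apply, simpleD, dotProduct, Fin.sum_univ_four, Matrix.mul_apply,
      Matrix.vecMul_diagonal]

theorem mrange_locRep : MonoidHom.mrange locRep = weylD := by
  apply le_antisymm
  · rintro _ ⟨w, rfl⟩
    exact locRep_mem_weylD w
  · refine Submonoid.closure_le.2 ?_
    rintro _ ⟨i, rfl⟩
    obtain ⟨A, hA⟩ := exists_localOp_eq_refl i
    refine ⟨QuotientGroup.mk ⟨A, mem_Nstar (g := locIncl A) hA⟩, ?_⟩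
    rw [← starRep_WlocToWstar]
    exact starRep_mk _ hA

/-! ### The qubit permutations -/

theorem starAction_qubitPerm (σ : Equiv.Perm (Fin 4)) (ψ : State) :
    starAction (qubitPerm σ) ψ = permOp σ ψ := by
  rw [starAction_apply, SemidirectProduct.left_inr, SemidirectProduct.right_inr, localOp_one]
  rfl

/-- The action of the three adjacent transpositions of qubits on the coordinates. -/
def swapRep : Fin 3 → Module.End ℂ (Fin 4 → ℂ) := ![reflShort, reflHalf, reflShort]

/-- The transpositions of adjacent qubits permute the entries `(a ± d) / 2`, `(b ± c) / 2` of the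
matrix `ψ̃`. -/
theorem permOp_cartanState (i : Fin 3) (d : Fin 4 → ℂ) :
    permOp (Equiv.swap i.castSucc i.succ) (cartanState d) = cartanState (swapRep i d) := by
  have key : ∀ a b c e : Fin 2,
      permOp (Equiv.swap i.castSucc i.succ) (cartanState d) ![a, b, c, e] =
        cartanState (swapRep i d) ![a, b, c, e] := by
    intro a b c e
    fin_cases i <;> fin_cases a <;> fin_cases b <;> fin_cases c <;> fin_cases e <;>
      simp [permOp_apply, cartanState, bitEquiv, cartanMat, swapRep, reflShort_apply,
        reflHalf_apply, Equiv.swap_apply_def, finProdFinEquiv] <;> ring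
  funext x
  have hx : x = ![x 0, x 1, x 2, x 3] := by
    ext j
    fin_cases j <;> rfl
  rw [hx]
  exact key _ _ _ _

theorem Rmat_swap (i : Fin 3) (d : Fin 4 → ℂ) :
    Rmat (starAction (qubitPerm (Equiv.swap i.castSucc i.succ)) (cartanState d)) =
      Matrix.diagonal (swapRep i d) := by
  rw [starAction_qubitPerm, permOp_cartanState, Rmat_cartanState]

theorem qubitPerm_mem_Nstar (σ : Equiv.Perm (Fin 4)) : qubitPerm σ ∈ Nstar := by
  have hσ : σ ∈ Submonoid.closure (Set.range fun i : Fin 3 => Equiv.swap i.castSucc i.succ) := by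
    rw [Equiv.Perm.mclosure_swap_castSucc_succ]
    trivial
  induction hσ using Submonoid.closure_induction with
  | mem σ hσ =>
    obtain ⟨i, rfl⟩ := hσ
    exact mem_Nstar (Rmat_swap i)
  | one => exact map_one qubitPerm ▸ one_mem _
  | mul σ τ _ _ h h' => exact map_mul qubitPerm σ τ ▸ mul_mem h h'

/-- The image of the qubit permutations in `W_𝔞^*`. -/
def permHom : Equiv.Perm (Fin 4) →* Wstar :=
  (QuotientGroup.mk' _).comp (qubitPerm.codRestrict Nstar qubitPerm_mem_Nstar)

theorem starRep_permHom_swap (i : Fin 3) :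
    starRep (permHom (Equiv.swap i.castSucc i.succ)) = swapRep i :=
  starRep_mk (qubitPerm_mem_Nstar _) (Rmat_swap i)

/-- The images of two adjacent qubit transpositions generate those of all qubit permutations, since
`(0 1)` and `(2 3)` have the same image in `W_𝔞^*`. -/
theorem permHom_mem_closure (σ : Equiv.Perm (Fin 4)) :
    permHom σ ∈ Submonoid.closure {permHom (Equiv.swap 0 1), permHom (Equiv.swap 1 2)} := by
  have hσ : σ ∈ Submonoid.closure (Set.range fun i : Fin 3 => Equiv.swap i.castSucc i.succ) := by
    rw [Equiv.Perm.mclosure_swap_castSucc_succ]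
    trivial
  induction hσ using Submonoid.closure_induction with
  | mem σ hσ =>
    obtain ⟨i, rfl⟩ := hσ
    apply Submonoid.subset_closure
    fin_cases i
    · exact Or.inl rfl
    · exact Or.inr rfl
    · refine Or.inl (starRep_injective ?_)
      exact (starRep_permHom_swap 2).trans (starRep_permHom_swap 0).symm
  | one => exact map_one permHom ▸ one_mem _
  | mul σ τ _ _ h h' => exact map_mul permHom σ τ ▸ mul_mem h h'

theorem starRep_permHom_mem_closure (σ : Equiv.Perm (Fin 4)) :
    starRep (permHom σ) ∈ Submonoid.closure {reflShort, reflHalf} := by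
  have h := Submonoid.mem_map_of_mem starRep (permHom_mem_closure σ)
  rw [MonoidHom.map_mclosure, Set.image_pair] at h
  have h0 : starRep (permHom (Equiv.swap 0 1)) = reflShort := starRep_permHom_swap 0
  have h1 : starRep (permHom (Equiv.swap 1 2)) = reflHalf := starRep_permHom_swap 1
  rwa [h0, h1] at h

/-- As the qubit permutations stabilize the Cartan subspace, both factors of an element of `N_𝔞^*`
in `SL_loc · Sym₄` belong to `N_𝔞^*`. -/
theorem exists_eq_WlocToWstar_mul_permHom (w : Wstar) :
    ∃ u σ, w = WlocToWstar u * permHom σ := by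
  obtain ⟨⟨g, hg⟩, rfl⟩ := QuotientGroup.mk_surjective w
  have hdecomp : g = locIncl g.left * qubitPerm g.right :=
    (SemidirectProduct.inl_left_mul_inr_right g).symm
  have hleft : locIncl g.left ∈ Nstar := by
    have h : locIncl g.left = g * (qubitPerm g.right)⁻¹ := eq_mul_inv_of_mul_eq hdecomp.symm
    rw [h]
    exact mul_mem hg (inv_mem (qubitPerm_mem_Nstar _))
  refine ⟨QuotientGroup.mk ⟨g.left, hleft⟩, g.right, ?_⟩
  change (QuotientGroup.mk (⟨g, hg⟩ : Nstar) : Wstar) =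
    QuotientGroup.mk (⟨locIncl g.left, hleft⟩ * ⟨qubitPerm g.right, qubitPerm_mem_Nstar _⟩)
  congr 1
  exact Subtype.ext hdecomp

/-! ### The group `W_𝔞^*` -/

theorem mrange_starRep : MonoidHom.mrange starRep = weylF := by
  apply le_antisymm
  · rintro _ ⟨w, rfl⟩
    obtain ⟨u, σ, rfl⟩ := exists_eq_WlocToWstar_mul_permHom w
    rw [map_mul, starRep_WlocToWstar]
    refine mul_mem (weylD_le_weylF (locRep_mem_weylD u)) ?_
    refine Submonoid.closure_le.2 ?_ (starRep_permHom_mem_closure σ)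
    rintro _ (rfl | rfl)
    · exact reflShort_mem_weylF
    · exact reflHalf_mem_weylF
  · have hD : weylD ≤ MonoidHom.mrange starRep := by
      rw [← mrange_locRep]
      rintro _ ⟨w, rfl⟩
      exact ⟨WlocToWstar w, starRep_WlocToWstar w⟩
    refine Submonoid.closure_le.2 ?_
    rintro _ ⟨i, rfl⟩
    fin_cases i
    · change refl (simpleF 0) ∈ _
      have h : simpleF 0 = (2 : ℤ) • ![0, 1, 0, -1] := by decide
      rw [h, refl_smul _ two_ne_zero]
      exact hD (refl_mem_weylD (by decide +kernel))
    · change refl (simpleF 1) ∈ _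
      have h : simpleF 1 = (2 : ℤ) • ![0, 0, -1, 1] := by decide
      rw [h, refl_smul _ two_ne_zero]
      exact hD (refl_mem_weylD (by decide +kernel))
    · exact ⟨_, starRep_permHom_swap 0⟩
    · exact ⟨_, starRep_permHom_swap 1⟩

/-- The Weyl group of type `F₄` is the union of three cosets of the group of signed permutations. -/
theorem range_starRep : Set.range starRep =
    Set.range fun t : (Fin 4 → ℤˣ) × Equiv.Perm (Fin 4) × Fin 3 =>
      signedPerm t.1 t.2.1 * cosetRep t.2.2 := by
  apply Set.Subset.antisymm
  · rintro _ ⟨w, rfl⟩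
    obtain ⟨u, σ, rfl⟩ := exists_eq_WlocToWstar_mul_permHom w
    obtain ⟨ε, π, -, hu⟩ := locRep_eq_signedPerm u
    obtain ⟨k, hk⟩ := exists_eq_mul_cosetRep (starRep_permHom_mem_closure σ)
    rw [map_mul, starRep_WlocToWstar, hu]
    rcases hk with hk | hk
    · exact ⟨(ε, π, k), by rw [hk]⟩
    · refine ⟨(ε * ![1, 1, -1, 1] ∘ π, π, k), ?_⟩
      rw [hk, ← mul_assoc, reflShort_eq_signedPerm, signedPerm_mul, one_mul]
  · rintro _ ⟨⟨ε, π, k⟩, rfl⟩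
    have h : signedPerm ε π * cosetRep k ∈ MonoidHom.mrange starRep := by
      rw [mrange_starRep]
      exact mul_mem (signedPerm_mem_weylF ε π) (cosetRep_mem_weylF k)
    exact h

theorem card_Wstar : Nat.card Wstar = 1152 := by
  rw [← Nat.card_range_of_injective starRep_injective, range_starRep,
    Nat.card_range_of_injective signedPerm_mul_cosetRep_injective, card_signedPerm_mul_cosetRep]

theorem closure_eq_top :
    Subgroup.closure (Set.range WlocToWstar ∪
      {permHom (Equiv.swap 0 1), permHom (Equiv.swap 1 2)}) = ⊤ := by
  refine top_unique fun w _ => ?_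
  obtain ⟨u, σ, rfl⟩ := exists_eq_WlocToWstar_mul_permHom w
  refine mul_mem (Subgroup.subset_closure (Or.inl ⟨u, rfl⟩)) ?_
  have h : Submonoid.closure {permHom (Equiv.swap 0 1), permHom (Equiv.swap 1 2)} ≤
      (Subgroup.closure (Set.range WlocToWstar ∪
        {permHom (Equiv.swap 0 1), permHom (Equiv.swap 1 2)})).toSubmonoid :=
    Submonoid.closure_le.2 fun x hx => Subgroup.subset_closure (Or.inr hx)
  exact h (permHom_mem_closure σ)

theorem Rmat_permHom_swap (i : Fin 3) (x : cartan) {d : Fin 4 → ℂ}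
    (hx : Rmat x = Matrix.diagonal d) :
    Rmat (WstarAction (permHom (Equiv.swap i.castSucc i.succ)) x) =
      Matrix.diagonal (swapRep i d) := by
  rw [Rmat_eq_diagonal_coord, coord_WstarAction, starRep_permHom_swap, coord_of_Rmat_eq hx]

end

end FourQubits

open FourQubits in
theorem mainTheorem7 :
    Nat.card Wstar = 1152 ∧
    IsWeylGroupOfType WstarAction CartanMatrix.F₄ ∧
    IsWeylGroupOfType WlocAction (CartanMatrix.D 4) ∧
    Function.Injective WlocToWstar ∧
    ∃ hN : ∀ σ : Equiv.Perm (Fin 4), qubitPerm σ ∈ Nstar,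
      let w : Equiv.Perm (Fin 4) → Wstar := fun σ => QuotientGroup.mk ⟨qubitPerm σ, hN σ⟩
      Subgroup.closure
          (Set.range WlocToWstar ∪ {w (Equiv.swap 0 1), w (Equiv.swap 1 2)}) = ⊤ ∧
      ∀ (x : cartan) (a b c d : ℂ), Rmat x = Matrix.diagonal ![a, b, c, d] →
        Rmat (WstarAction (w (Equiv.swap 0 1)) x) = Matrix.diagonal ![a, b, -c, d] ∧
        Rmat (WstarAction (w (Equiv.swap 1 2)) x) =
          (1 / 2 : ℂ) • Matrix.diagonal
            ![a + b + c + d, a + b - c - d, a - b + c - d, a - b - c + d] := by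
  refine ⟨card_Wstar, ?_, ?_, WlocToWstar_injective, qubitPerm_mem_Nstar, closure_eq_top, ?_⟩
  · exact isWeylGroupOfType_of_mrange_eq isIntegerRootSystem_F coord WstarAction starRep
      coord_WstarAction starRep_injective mrange_starRep
  · exact isWeylGroupOfType_of_mrange_eq isIntegerRootSystem_D coord WlocAction locRep
      coord_WlocAction locRep_injective mrange_locRep
  · intro x a b c d hx
    refine ⟨(Rmat_permHom_swap 0 x hx).trans ?_, (Rmat_permHom_swap 1 x hx).trans ?_⟩
    · change Matrix.diagonal (reflShort ![a, b, c, d]) = _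
      rw [reflShort_apply]
      rfl
    · change Matrix.diagonal (reflHalf ![a, b, c, d]) = _
      rw [reflHalf_apply, Matrix.diagonal_smul]
      rfl
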